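/- An \emph{$m$-gon} is a spherical building of rank $2$ with Weyl group the dihedral group of order $2m$, viewed as a $1$-dimensional simplicial complex $\Delta$; its apartments are circuits of length $2m$, its chambers are its edges, and two chambers are \emph{adjacent} if they have a common vertex (in particular a chamber is adjacent to itself). It is \emph{thick} if every vertex lies in at least three chambers. Two chambers are \emph{opposite} if their gallery distance equals the diameter $m$. Fix an ordering of the two types of vertices, so that the set $\mathrm{Ch}\,\Delta$ of chambers is viewed as a set of ordered pairs of vertices. A \emph{compact $m$-gon} is an $m$-gon $\Delta$ whose vertex set $\mathrm{Vert}\,\Delta$ carries a compact metrizable topology for which $\mathrm{Ch}\,\Delta$ is closed in $(\mathrm{Vert}\,\Delta)^2$; then $\mathrm{Ch}\,\Delta$ carries the induced topology. Let $\mathrm{Aut}_{\mathrm{top}}(\Delta)$ be the group of all simplicial automorphisms of $\Delta$ (not necessarily type-preserving) that induce homeomorphisms of $\mathrm{Vert}\,\Delta$ and of $\mathrm{Ch}\,\Delta$, with the topology induced by the compact-open topology of $C(\mathrm{Ch}\,\Delta,\mathrm{Ch}\,\Delta)$. Let $\Delta$ be a thick compact $m$-gon with $m \ge 3$, let $\rho$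 be a metric on $\mathrm{Ch}\,\Delta$ inducing its topology, and let $C, C'$ be opposite chambers of $\Delta$. Denote by $E_1(C)$ the set of chambers adjacent to $C$. Then there exists $\varepsilon > 0$ such that the set $$L_\varepsilon(C,C') := \{ \varphi \in \mathrm{Aut}_{\mathrm{top}}(\Delta) \mid \rho(X, \varphi(X)) \le \varepsilon \text{ for all } X \in E_1(C) \cup \{C'\} \}$$ is a compact subset of $\mathrm{Aut}_{\mathrm{top}}(\Delta)$. -/

import Mathlib

open Topology

/-! Polygons (spherical buildings of rank `2`), viewed as one-dimensional simplicial complexes,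
i.e. as simple graphs: the vertices of the complex are the vertices of the graph, the chambers
are its edges and the panels are its vertices. -/

section Apartments

variable {V : Type*} {Γ : SimpleGraph V}

/-- `s` is (the vertex set of) a nonempty simplex of the subcomplex `A`. -/
def SimpleGraph.Subgraph.HasSimplex (A : Γ.Subgraph) (s : Set V) : Prop :=
  (∃ v ∈ A.verts, s = {v}) ∨ ∃ u v, A.Adj u v ∧ s = {u, v}

/-- `𝒜` is a system of apartments that makes the one-dimensional complex `Γ` a building of rank
`2` with Weyl group the dihedral group of order `2 * m`: the usual axioms of a building, where
the Coxeter complex is the circuit of length `2 * m`. -/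
structure IsApartmentSystem (Γ : SimpleGraph V) (m : ℕ) (𝒜 : Set Γ.Subgraph) : Prop where
  /-- Every apartment is a circuit with `2 * m` vertices. -/
  coxeter : ∀ A ∈ 𝒜, Nonempty (A.coe ≃g SimpleGraph.cycleGraph (2 * m))
  /-- Any two simplices lie in a common apartment. -/
  exists_mem : ∀ s t : Set V, (⊤ : Γ.Subgraph).HasSimplex s → (⊤ : Γ.Subgraph).HasSimplex t →
    ∃ A ∈ 𝒜, A.HasSimplex s ∧ A.HasSimplex t
  /-- If two apartments contain two simplices, there is an isomorphism between the apartments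
  that fixes these two simplices pointwise. -/
  exists_iso : ∀ A ∈ 𝒜, ∀ A' ∈ 𝒜, ∀ s t : Set V,
    A.HasSimplex s → A.HasSimplex t → A'.HasSimplex s → A'.HasSimplex t →
    ∃ f : A.coe ≃g A'.coe, ∀ v : A.verts, (v : V) ∈ s ∪ t → (f v : V) = v

end Apartments

/-- An `m`-gon with vertex set `V`: a spherical building of rank `2` and diameter `m`, together
with an ordering of its two types of vertices. -/
structure RankTwoBuilding (V : Type*) (m : ℕ) where
  graph : SimpleGraph V
  /-- The type of a vertex; the two vertices of a chamber have different types. -/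
  typ : graph.Coloring (Fin 2)
  exists_apartments : ∃ 𝒜 : Set graph.Subgraph, IsApartmentSystem graph m 𝒜

namespace RankTwoBuilding

variable {V : Type*} {m : ℕ} (Δ : RankTwoBuilding V m)

/-- Thickness: every panel (vertex) is contained in at least three chambers. -/
def IsThick : Prop :=
  ∀ v : V, 3 ≤ (Δ.graph.neighborSet v).encard

/-- The chambers, as pairs of vertices ordered according to their type. -/
def chamberSet : Set (V × V) :=
  {p | Δ.graph.Adj p.1 p.2 ∧ Δ.typ p.1 = 0 ∧ Δ.typ p.2 = 1}

/-- The type of chambers; over a topological space `V` it carries the topology induced by the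
product topology of `V × V`. -/
abbrev Chamber : Type _ := Δ.chamberSet

variable {Δ} in
/-- Two chambers share a panel. A chamber shares its panels with itself. -/
def Chamber.SharePanel (C D : Δ.Chamber) : Prop :=
  C.1.1 = D.1.1 ∨ C.1.2 = D.1.2

/-- The set `E₁(C)` of chambers adjacent to `C` (having a panel in common with `C`). -/
def adjacentChambers (C : Δ.Chamber) : Set Δ.Chamber :=
  {X | Chamber.SharePanel X C}

/-- The chamber graph; its walks are the (non-stammering) galleries. -/
def chamberGraph : SimpleGraph Δ.Chamber where
  Adj C D := C ≠ D ∧ Chamber.SharePanel C D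
  symm := ⟨fun _ _ h => ⟨h.1.symm, h.2.imp Eq.symm Eq.symm⟩⟩
  loopless := ⟨fun _ h => h.1 rfl⟩

variable {Δ} in
/-- Two chambers of an `m`-gon are opposite if their gallery distance is the diameter `m`. -/
def Opposite (C C' : Δ.Chamber) : Prop :=
  Δ.chamberGraph.dist C C' = m

/-- The chamber whose vertices are the two adjacent vertices `x`, `y`. -/
def chamberOfAdj {x y : V} (h : Δ.graph.Adj x y) : Δ.Chamber :=
  if hx : Δ.typ x = 0 then
    ⟨(x, y), h, hx, by have := Δ.typ.valid h; simp only; omega⟩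
  else
    ⟨(y, x), h.symm, by have := Δ.typ.valid h; simp only; omega, by simp only; omega⟩

/-- The action of an automorphism of `Δ` (a simplicial automorphism, which may exchange the two
types) on chambers. -/
def chamberMap (φ : Δ.graph ≃g Δ.graph) (C : Δ.Chamber) : Δ.Chamber :=
  Δ.chamberOfAdj (φ.map_adj_iff.2 C.2.1)

theorem chamberOfAdj_symm {x y : V} (h : Δ.graph.Adj x y) :
    Δ.chamberOfAdj h.symm = Δ.chamberOfAdj h := by
  have := Δ.typ.valid h
  unfold chamberOfAdj
  split_ifs with h1 h2 h2
  · exact absurd (h2.trans h1.symm) this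
  · rfl
  · rfl
  · omega

theorem chamberMap_chamberOfAdj (φ : Δ.graph ≃g Δ.graph) {x y : V} (h : Δ.graph.Adj x y) :
    Δ.chamberMap φ (Δ.chamberOfAdj h) = Δ.chamberOfAdj (φ.map_adj_iff.2 h) := by
  by_cases hx : Δ.typ x = 0
  · have : Δ.chamberOfAdj h = ⟨(x, y), h, hx, by have := Δ.typ.valid h; simp only; omega⟩ :=
      dif_pos hx
    rw [this]; rfl
  · have : Δ.chamberOfAdj h = ⟨(y, x), h.symm, by have := Δ.typ.valid h; simp only; omega,
        by simp only; omega⟩ := dif_neg hx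
    rw [this]
    exact Δ.chamberOfAdj_symm (φ.map_adj_iff.2 h)

theorem chamberMap_one : Δ.chamberMap 1 = id := by
  funext C
  exact dif_pos C.2.2.1

theorem chamberMap_mul (φ ψ : Δ.graph ≃g Δ.graph) :
    Δ.chamberMap (φ * ψ) = Δ.chamberMap φ ∘ Δ.chamberMap ψ := by
  funext C
  exact (Δ.chamberMap_chamberOfAdj φ (ψ.map_adj_iff.2 C.2.1)).symm

section Topology

theorem isHomeomorph_of_inverse {X : Type*} [TopologicalSpace X] {f g : X → X}
    (hf : IsHomeomorph f) (h1 : Function.LeftInverse g f) (h2 : Function.RightInverse g f) :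
    IsHomeomorph g := by
  obtain ⟨hc, k, hk1, -, hk3⟩ := isHomeomorph_iff_exists_inverse.1 hf
  have hgk : g = k := funext fun x => by rw [← hk1 (g x), h2 x]
  exact isHomeomorph_iff_exists_inverse.2 ⟨hgk ▸ hk3, f, h2, h1, hc⟩

variable [TopologicalSpace V]

/-- A compact polygon: the vertex set carries a compact metrizable topology for which the set of
chambers is closed in `V × V`. -/
structure IsCompactBuilding : Prop where
  compactSpace : CompactSpace V
  metrizableSpace : TopologicalSpace.MetrizableSpace V
  isClosed_chamberSet : IsClosed Δ.chamberSet

/-- The topological automorphism group: the automorphisms of `Δ` that are homeomorphisms on the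
set of vertices and on the set of chambers. -/
def topAut : Subgroup (Δ.graph ≃g Δ.graph) where
  carrier := {φ | IsHomeomorph (φ : V → V) ∧ IsHomeomorph (Δ.chamberMap φ)}
  mul_mem' := by
    rintro φ ψ ⟨h1, h2⟩ ⟨h3, h4⟩
    exact ⟨h1.comp h3, by rw [chamberMap_mul]; exact h2.comp h4⟩
  one_mem' := ⟨IsHomeomorph.id, by rw [chamberMap_one]; exact IsHomeomorph.id⟩
  inv_mem' := by
    rintro φ ⟨h1, h2⟩
    refine ⟨isHomeomorph_of_inverse h1 φ.left_inv φ.right_inv,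
      isHomeomorph_of_inverse h2 (fun C => ?_) (fun C => ?_)⟩
    · have := congrFun (Δ.chamberMap_mul φ⁻¹ φ) C
      rw [inv_mul_cancel, chamberMap_one] at this
      exact this.symm
    · have := congrFun (Δ.chamberMap_mul φ φ⁻¹) C
      rw [mul_inv_cancel, chamberMap_one] at this
      exact this.symm

/-- The continuous self-map of the space of chambers given by a topological automorphism. -/
def topAutToContinuousMap (φ : Δ.topAut) : C(Δ.Chamber, Δ.Chamber) :=
  ⟨Δ.chamberMap φ, φ.2.2.continuous⟩

/-- The topology of `Δ.topAut` induced by the compact-open topology. -/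
instance : TopologicalSpace Δ.topAut :=
  TopologicalSpace.induced Δ.topAutToContinuousMap inferInstance

/-- The set `L_ε(C, C')` of topological automorphisms that move every chamber adjacent to `C`,
and also `C'`, by at most `ε` with respect to the metric `ρ`. -/
def almostFixing (ρ : MetricSpace Δ.Chamber) (C C' : Δ.Chamber) (ε : ℝ) : Set Δ.topAut :=
  {φ | ∀ X ∈ Δ.adjacentChambers C ∪ {C'}, ρ.dist X (Δ.chamberMap φ X) ≤ ε}

end Topology

end RankTwoBuilding

/-! Compactness is tested on ultrafilters: an ultrafilter `U` containing the set must converge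
inside it. For a family `a` of vertices indexed by the automorphisms, let `s a` be its limit along
`U` and `t a` the limit of the moved family `φ (a φ)`. Both are homomorphisms from the ultrapower of
the incidence graph onto that graph. If they identify the same families, then `t` factors as `f ∘ s`
with `f` an automorphism and homeomorphism (`ResiduePair.exists_limit_iso`), and `U` converges to
`f`.

The tool is projection between the neighbours of opposite vertices, a continuous bijection. Walks in
the ultrapower realise it for `s` and `t` at once, so local properties travel between vertices,
provided that all vertices are `Good`. Small displacement gives goodness at the two vertices of `C`,
and it spreads from there (`ResiduePair.good_of_good`).

Suppose that `s` identifies two neighbours that `t` distinguishes (`Splits`). If moreover `t` brings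
together neighbours that `s` distinguishes (`Merges`), a suitable configuration yields a neighbour
`z` of a vertex `p` of `C` whose limit is that of `a` but whose moved limit is near that of `b`;
small displacement forbids this (`ResiduePair.not_merges_of_splits`). So a splitting excludes
merging, compactness then makes the panels finite, and on a finite panel of `C` the map `t` is a
bijection, which excludes splitting. With splitting excluded in both directions, `s` and `t`
identify the same neighbours, hence the same vertices (`ResiduePair.eq_iff_eq`). -/

/-! ### Cyclic coordinates on apartments -/

section Circuits

variable {V : Type*} {Γ : SimpleGraph V} {m : ℕ}

/-- `l` runs periodically around the circuit `A` of length `2 * m`. -/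
structure IsCircuitLabelling (A : Γ.Subgraph) (m : ℕ) (l : ℤ → V) : Prop where
  eq_iff : ∀ i j, l i = l j ↔ (2 * m : ℤ) ∣ i - j
  mem_iff : ∀ v, v ∈ A.verts ↔ ∃ i, l i = v
  adj_iff : ∀ i w, A.Adj (l i) w ↔ w = l (i + 1) ∨ w = l (i - 1)

theorem Fin.val_sub_eq_one_iff {n : ℕ} (hn : 2 ≤ n) (a b : Fin n) :
    (a - b).val = 1 ↔ (n : ℤ) ∣ (a.val : ℤ) - b.val - 1 := by
  have ha := a.2
  have hb := b.2
  rw [Fin.sub_def]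
  simp only
  constructor
  · intro h
    have := Nat.div_add_mod (n - b.val + a.val) n
    rw [h] at this
    refine ⟨((n - b.val + a.val) / n : ℕ) - 1, ?_⟩
    have h2 : ((n * ((n - b.val + a.val) / n) + 1 : ℕ) : ℤ) = ((n - b.val + a.val : ℕ) : ℤ) := by
      rw [this]
    push_cast [Nat.cast_sub hb.le] at h2 ⊢
    rw [mul_sub]
    linarith
  · rintro ⟨k, hk⟩
    have hk' : k = 0 ∨ k = -1 := by
      have h1 : k < 1 := by by_contra hc; nlinarith
      have h2 : -2 < k := by by_contra hc; nlinarith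
      omega
    rcases hk' with rfl | rfl
    · have : n - b.val + a.val = n + 1 := by omega
      rw [this, Nat.add_mod_left, Nat.mod_eq_of_lt (by omega)]
    · have : n - b.val + a.val = 1 := by omega
      rw [this, Nat.mod_eq_of_lt (by omega)]

theorem IsCircuitLabelling.exists_of_iso (hm : 1 ≤ m) {A : Γ.Subgraph}
    (f : A.coe ≃g SimpleGraph.cycleGraph (2 * m)) : ∃ l, IsCircuitLabelling A m l := by
  have hn : (0 : ℤ) < 2 * m := by omega
  let r : ℤ → Fin (2 * m) := fun i =>
    ⟨(i % (2 * m)).toNat, by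
      have h1 := Int.emod_lt_of_pos i hn
      have h2 := Int.emod_nonneg i hn.ne'
      omega⟩
  have hr : ∀ i, ((r i).val : ℤ) = i % (2 * m) := fun i =>
    Int.toNat_of_nonneg (Int.emod_nonneg i hn.ne')
  have hrs : ∀ a : Fin (2 * m), r a.val = a := fun a => by
    apply Fin.ext
    have h1 := hr a.val
    rw [Int.emod_eq_of_lt (by omega) (by have := a.2; omega)] at h1
    exact_mod_cast h1
  have hreq : ∀ i j, r i = r j ↔ (2 * m : ℤ) ∣ i - j := fun i j => by
    rw [Fin.ext_iff, ← Int.modEq_iff_dvd, Int.ModEq, ← hr, ← hr, Nat.cast_inj, eq_comm]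
  have hradj : ∀ i j, ((r j).val - (r i).val : ℤ) - 1 = j - i - 1 - (2 * m) * (j / (2 * m) - i / (2 * m)) := by
    intro i j
    rw [hr, hr, Int.emod_def, Int.emod_def]; ring
  have hrdvd : ∀ i j, (r j - r i).val = 1 ↔ (2 * m : ℤ) ∣ j - i - 1 := fun i j => by
    rw [Fin.val_sub_eq_one_iff (by omega), hradj]
    push_cast
    exact dvd_sub_left (dvd_mul_right _ _)
  refine ⟨fun i => f.symm (r i), ?_, ?_, ?_⟩
  · intro i j
    rw [← hreq, Subtype.val_inj]
    exact f.symm.injective.eq_iff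
  · intro v
    constructor
    · intro hv
      refine ⟨(f ⟨v, hv⟩).val, ?_⟩
      rw [hrs]; simp
    · rintro ⟨i, rfl⟩; exact Subtype.coe_prop _
  · have key : ∀ i j, A.Adj (f.symm (r i)) (f.symm (r j)) ↔ (r j = r (i + 1) ∨ r j = r (i - 1)) := by
      intro i j
      rw [← SimpleGraph.Subgraph.coe_adj, f.symm.map_adj_iff, SimpleGraph.cycleGraph_adj', hrdvd,
        hrdvd, hreq, hreq, or_comm, ← dvd_neg (b := i - j - 1)]
      ring_nf
    intro i w
    constructor
    · intro h
      have hw := h.snd_mem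
      have e : w = f.symm (r (f ⟨w, hw⟩).val) := by rw [hrs]; simp
      rw [e] at h ⊢
      rcases (key _ _).1 h with h | h
      · left; rw [h]
      · right; rw [h]
    · rintro (rfl | rfl)
      · exact (key _ _).2 (Or.inl rfl)
      · exact (key _ _).2 (Or.inr rfl)

namespace IsCircuitLabelling

variable {A : Γ.Subgraph} {l : ℤ → V}

theorem shift (h : IsCircuitLabelling A m l) (k : ℤ) :
    IsCircuitLabelling A m fun i => l (k + i) where
  eq_iff i j := by rw [h.eq_iff]; ring_nf
  mem_iff v := by
    rw [h.mem_iff]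
    exact ⟨fun ⟨i, hi⟩ => ⟨i - k, by rw [← hi]; ring_nf⟩, fun ⟨i, hi⟩ => ⟨_, hi⟩⟩
  adj_iff i w := by rw [h.adj_iff]; ring_nf

theorem reflect (h : IsCircuitLabelling A m l) : IsCircuitLabelling A m fun i => l (-i) where
  eq_iff i j := by rw [h.eq_iff, ← dvd_neg]; ring_nf
  mem_iff v := by
    rw [h.mem_iff]
    exact ⟨fun ⟨i, hi⟩ => ⟨-i, by rw [← hi]; ring_nf⟩, fun ⟨i, hi⟩ => ⟨_, hi⟩⟩
  adj_iff i w := by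
    rw [h.adj_iff, or_comm]; ring_nf

theorem exists_base (h : IsCircuitLabelling A m l) {a b : V} (hab : A.Adj a b) :
    ∃ l', IsCircuitLabelling A m l' ∧ l' 0 = a ∧ l' 1 = b := by
  obtain ⟨k, rfl⟩ := (h.mem_iff a).1 hab.fst_mem
  rcases (h.adj_iff _ _).1 hab with rfl | rfl
  · exact ⟨_, h.shift k, by simp, rfl⟩
  · exact ⟨_, (h.shift k).reflect, by simp, rfl⟩

theorem map_iso (h : IsCircuitLabelling A m l) {A' : Γ.Subgraph} (f : A.coe ≃g A'.coe) :
    IsCircuitLabelling A' m fun i => f ⟨l i, (h.mem_iff _).2 ⟨i, rfl⟩⟩ where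
  eq_iff i j := by
    rw [Subtype.val_inj, f.injective.eq_iff, Subtype.mk.injEq, h.eq_iff]
  mem_iff v := by
    constructor
    · intro hv
      obtain ⟨i, hi⟩ := (h.mem_iff _).1 (f.symm ⟨v, hv⟩).2
      refine ⟨i, ?_⟩
      simp only [hi, Subtype.coe_eta, RelIso.apply_symm_apply]
    · rintro ⟨i, rfl⟩; exact Subtype.coe_prop _
  adj_iff i w := by
    constructor
    · intro hw
      have e : A.Adj (l i) (f.symm ⟨w, hw.snd_mem⟩) := by
        have : A'.coe.Adj (f ⟨l i, (h.mem_iff _).2 ⟨i, rfl⟩⟩) ⟨w, hw.snd_mem⟩ := hw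
        rw [← f.symm.map_adj_iff] at this
        simpa using this
      have e2 : w = f (f.symm ⟨w, hw.snd_mem⟩) := by simp
      rcases (h.adj_iff _ _).1 e with e | e
      · left; rw [e2]; congr 2; exact Subtype.ext e
      · right; rw [e2]; congr 2; exact Subtype.ext e
    · have key : ∀ j, A.Adj (l i) (l j) → A'.Adj (f ⟨l i, (h.mem_iff _).2 ⟨i, rfl⟩⟩)
          (f ⟨l j, (h.mem_iff _).2 ⟨j, rfl⟩⟩) := by
        intro j hj
        rw [← SimpleGraph.Subgraph.coe_adj, f.map_adj_iff]; exact hj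
      rintro (rfl | rfl)
      · exact key _ ((h.adj_iff _ _).2 (Or.inl rfl))
      · exact key _ ((h.adj_iff _ _).2 (Or.inr rfl))

/-- A vertex of the circuit has only two neighbours, and these differ because `2 ≤ m`; so two
consecutive values force the next one in either direction. -/
theorem congr_of_base (hm : 2 ≤ m) (h : IsCircuitLabelling A m l) {l' : ℤ → V}
    (h' : IsCircuitLabelling A m l') (h0 : l 0 = l' 0) (h1 : l 1 = l' 1) : l = l' := by
  have up : ∀ i, l i = l' i → l (i + 1) = l' (i + 1) → l (i + 2) = l' (i + 2) := by
    intro i e0 e1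
    have e : A.Adj (l (i + 1)) (l (i + 2)) := (h.adj_iff _ _).2 (Or.inl (by ring_nf))
    rw [e1] at e
    rcases (h'.adj_iff _ _).1 e with e | e
    · rw [e]; ring_nf
    · exfalso
      rw [add_sub_cancel_right, ← e0, h.eq_iff] at e
      have := Int.le_of_dvd (by omega) e
      omega
  have down : ∀ i, l i = l' i → l (i + 1) = l' (i + 1) → l (i - 1) = l' (i - 1) := by
    intro i e0 e1
    have e : A.Adj (l i) (l (i - 1)) := (h.adj_iff _ _).2 (Or.inr (by ring_nf))
    rw [e0] at e
    rcases (h'.adj_iff _ _).1 e with e | e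
    · exfalso
      rw [← e1, h.eq_iff, ← dvd_neg] at e
      have := Int.le_of_dvd (by omega) e
      omega
    · exact e
  have all : ∀ i, l i = l' i ∧ l (i + 1) = l' (i + 1) := by
    intro i
    induction i with
    | zero => exact ⟨h0, h1⟩
    | succ i ih => exact ⟨ih.2, by rw [add_assoc]; exact up _ ih.1 ih.2⟩
    | pred i ih => exact ⟨down _ ih.1 ih.2, by simpa using ih.1⟩
  exact funext fun i => (all i).1

theorem adj_succ (h : IsCircuitLabelling A m l) (i : ℤ) : Γ.Adj (l i) (l (i + 1)) :=
  ((h.adj_iff _ _).2 (Or.inl rfl)).adj_sub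

theorem exists_walk (h : IsCircuitLabelling A m l) (i : ℤ) (k : ℕ) :
    ∃ w : Γ.Walk (l i) (l (i + k)), w.length = k := by
  induction k with
  | zero => exact ⟨SimpleGraph.Walk.nil.copy rfl (by simp), by simp⟩
  | succ k ih =>
    obtain ⟨w, hw⟩ := ih
    exact ⟨(w.concat (h.adj_succ _)).copy rfl (by push_cast; ring_nf), by simp [hw]⟩

end IsCircuitLabelling

theorem SimpleGraph.Subgraph.hasSimplex_singleton {A : Γ.Subgraph} {v : V} :
    A.HasSimplex {v} ↔ v ∈ A.verts := by
  constructor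
  · rintro (⟨w, hw, e⟩ | ⟨u, w, h, e⟩)
    · rw [Set.singleton_eq_singleton_iff] at e; exact e ▸ hw
    · have : u = v := by have : u ∈ ({v} : Set V) := e ▸ by simp
                         simpa using this
      exact this ▸ h.fst_mem
  · exact fun h => Or.inl ⟨v, h, rfl⟩

theorem SimpleGraph.Subgraph.hasSimplex_pair {A : Γ.Subgraph} {a b : V} (hab : a ≠ b) :
    A.HasSimplex {a, b} ↔ A.Adj a b := by
  constructor
  · rintro (⟨w, hw, e⟩ | ⟨u, w, h, e⟩)
    · exfalso
      have h1 : a ∈ ({w} : Set V) := e ▸ by simp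
      have h2 : b ∈ ({w} : Set V) := e ▸ by simp
      exact hab ((Set.mem_singleton_iff.1 h1).trans (Set.mem_singleton_iff.1 h2).symm)
    · rcases Set.pair_eq_pair_iff.1 e with ⟨rfl, rfl⟩ | ⟨rfl, rfl⟩
      · exact h
      · exact h.symm
  · exact fun h => Or.inr ⟨a, b, h, rfl⟩

namespace IsApartmentSystem

variable {𝒜 : Set Γ.Subgraph}

theorem exists_labelling (h : IsApartmentSystem Γ m 𝒜) (hm : 2 ≤ m) {A : Γ.Subgraph} (hA : A ∈ 𝒜)
    {a b : V} (hab : A.Adj a b) :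
    ∃ l, IsCircuitLabelling A m l ∧ l 0 = a ∧ l 1 = b := by
  obtain ⟨f⟩ := h.coxeter A hA
  obtain ⟨l, hl⟩ := IsCircuitLabelling.exists_of_iso (by omega) f
  exact hl.exists_base hab

/-- The position of a vertex in an apartment relative to a chamber does not depend on the
apartment. -/
theorem labelling_apply_eq (h : IsApartmentSystem Γ m 𝒜) (hm : 2 ≤ m) {A A' : Γ.Subgraph}
    (hA : A ∈ 𝒜) (hA' : A' ∈ 𝒜) {l l' : ℤ → V} (hl : IsCircuitLabelling A m l)
    (hl' : IsCircuitLabelling A' m l') (h0 : l 0 = l' 0) (h1 : l 1 = l' 1) {i j : ℤ}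
    (hij : l i = l' j) : (2 * m : ℤ) ∣ i - j := by
  have hadj : A.Adj (l 0) (l 1) := (hl.adj_iff _ _).2 (Or.inl (by simp))
  have hadj' : A'.Adj (l 0) (l 1) := by rw [h0, h1]; exact (hl'.adj_iff _ _).2 (Or.inl (by simp))
  obtain ⟨f, hf⟩ := h.exists_iso A hA A' hA' {l 0, l 1} {l i}
    (Or.inr ⟨_, _, hadj, rfl⟩)
    (SimpleGraph.Subgraph.hasSimplex_singleton.2 ((hl.mem_iff _).2 ⟨i, rfl⟩))
    (Or.inr ⟨_, _, hadj', rfl⟩)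
    (SimpleGraph.Subgraph.hasSimplex_singleton.2 ((hl'.mem_iff _).2 ⟨j, hij.symm⟩))
  have e := (hl.map_iso f).congr_of_base hm hl' ((hf _ (by simp)).trans h0)
    ((hf _ (by simp)).trans h1)
  have e2 := (hf ⟨l i, (hl.mem_iff _).2 ⟨i, rfl⟩⟩ (by simp)).symm.trans (congrFun e i)
  exact (hl'.eq_iff _ _).1 (e2.symm.trans hij)

theorem exists_apartment_adj_mem (h : IsApartmentSystem Γ m 𝒜) {a b v : V} (hab : Γ.Adj a b) :
    ∃ A ∈ 𝒜, A.Adj a b ∧ v ∈ A.verts := by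
  obtain ⟨A, hA, h1, h2⟩ := h.exists_mem {a, b} {v} (Or.inr ⟨a, b, hab, rfl⟩)
    (Or.inl ⟨v, trivial, rfl⟩)
  exact ⟨A, hA, (SimpleGraph.Subgraph.hasSimplex_pair hab.ne).1 h1,
    SimpleGraph.Subgraph.hasSimplex_singleton.1 h2⟩

theorem exists_apartment_adj_adj (h : IsApartmentSystem Γ m 𝒜) {a b c d : V} (hab : Γ.Adj a b)
    (hcd : Γ.Adj c d) : ∃ A ∈ 𝒜, A.Adj a b ∧ A.Adj c d := by
  obtain ⟨A, hA, h1, h2⟩ := h.exists_mem {a, b} {c, d} (Or.inr ⟨a, b, hab, rfl⟩)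
    (Or.inr ⟨c, d, hcd, rfl⟩)
  exact ⟨A, hA, (SimpleGraph.Subgraph.hasSimplex_pair hab.ne).1 h1,
    (SimpleGraph.Subgraph.hasSimplex_pair hcd.ne).1 h2⟩

/-- The position of `v` relative to the chamber `{a, b}` is `i`. -/
def HasPosition (𝒜 : Set Γ.Subgraph) (m : ℕ) (a b v : V) (i : ℤ) : Prop :=
  ∃ A ∈ 𝒜, ∃ l, IsCircuitLabelling A m l ∧ l 0 = a ∧ l 1 = b ∧ l i = v

theorem HasPosition.dvd_sub (h : IsApartmentSystem Γ m 𝒜) (hm : 2 ≤ m) {a b v : V} {i j : ℤ}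
    (hi : HasPosition 𝒜 m a b v i) (hj : HasPosition 𝒜 m a b v j) : (2 * m : ℤ) ∣ i - j := by
  obtain ⟨A, hA, l, hl, rfl, rfl, rfl⟩ := hi
  obtain ⟨A', hA', l', hl', h0, h1, h2⟩ := hj
  exact h.labelling_apply_eq hm hA hA' hl hl' h0.symm h1.symm h2.symm

theorem exists_hasPosition_adj (h : IsApartmentSystem Γ m 𝒜) (hm : 2 ≤ m) {a b v w : V}
    (hab : Γ.Adj a b) (hvw : Γ.Adj v w) :
    ∃ i j, HasPosition 𝒜 m a b v i ∧ HasPosition 𝒜 m a b w j ∧ (j = i + 1 ∨ j = i - 1) := by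
  obtain ⟨A, hA, h1, h2⟩ := h.exists_apartment_adj_adj hab hvw
  obtain ⟨l, hl, e0, e1⟩ := h.exists_labelling hm hA h1
  obtain ⟨i, rfl⟩ := (hl.mem_iff v).1 h2.fst_mem
  rcases (hl.adj_iff _ _).1 h2 with rfl | rfl
  · exact ⟨i, i + 1, ⟨A, hA, l, hl, e0, e1, rfl⟩, ⟨A, hA, l, hl, e0, e1, rfl⟩, Or.inl rfl⟩
  · exact ⟨i, i - 1, ⟨A, hA, l, hl, e0, e1, rfl⟩, ⟨A, hA, l, hl, e0, e1, rfl⟩, Or.inr rfl⟩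

/-- Position relative to a fixed chamber changes by `±1` along an edge, so it is 1-Lipschitz modulo
`2 * m`. This replaces the retraction onto an apartment. -/
theorem exists_dvd_of_walk (h : IsApartmentSystem Γ m 𝒜) (hm : 2 ≤ m) {a b : V} (hab : Γ.Adj a b)
    {v w : V} (p : Γ.Walk v w) {i j : ℤ} (hi : HasPosition 𝒜 m a b v i)
    (hj : HasPosition 𝒜 m a b w j) : ∃ z : ℤ, |z| ≤ p.length ∧ (2 * m : ℤ) ∣ j - i - z := by
  induction p generalizing i with
  | nil => exact ⟨0, by simp, by simpa using hj.dvd_sub h hm hi⟩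
  | cons e p ih =>
    obtain ⟨i', k, h1, h2, h3⟩ := h.exists_hasPosition_adj hm hab e
    obtain ⟨z, hz, hd⟩ := ih h2 hj
    have hii := hi.dvd_sub h hm h1
    rw [SimpleGraph.Walk.length_cons]
    refine ⟨z + (k - i'), ?_, ?_⟩
    · push_cast
      refine (abs_add_le _ _).trans (add_le_add hz ?_)
      rcases h3 with rfl | rfl <;> simp
    · have := dvd_sub hd hii
      rwa [show j - i - (z + (k - i')) = j - k - z - (i - i') by ring]

end IsApartmentSystem

end Circuits

/-! ### From apartments to distances -/

/-- The metric properties of the incidence graph of a generalized polygon: it is connected of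
diameter at most `m`, and at distance less than `m` geodesics are unique. -/
structure SimpleGraph.IsGeneralizedPolygon {V : Type*} (G : SimpleGraph V) (m : ℕ) : Prop where
  connected : G.Connected
  dist_le : ∀ x y, G.dist x y ≤ m
  eq_of_dist_lt : ∀ x y a b, G.dist x y < m → G.Adj y a → G.Adj y b →
    G.dist x a < G.dist x y → G.dist x b < G.dist x y → a = b

theorem Int.abs_le_of_dvd_sub {n j z : ℤ} (h : n ∣ j - z) (h1 : |j| + |z| < n) : j = z := by
  have h2 : |j - z| < n := (abs_sub _ _).trans_lt h1
  have := Int.eq_zero_of_abs_lt_dvd h h2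
  omega

/-- Put `b`, `y`, `a` at positions `-1`, `0`, `1` of one apartment and let `x` have position `j`
relative to `y`, `a`. The Lipschitz bound makes the distances from `x` to `a` and `b` at least `|j -
1|` and `|j + 1|`. One of these is `|j| + 1`, so `a` and `b` cannot both be nearer to `x` than `y`.
-/
theorem IsApartmentSystem.isGeneralizedPolygon {V : Type*} {Γ : SimpleGraph V} {m : ℕ}
    {𝒜 : Set Γ.Subgraph} (h : IsApartmentSystem Γ m 𝒜) (hm : 2 ≤ m) [Nonempty V]
    (hnb : ∀ v, ∃ w, Γ.Adj v w) : Γ.IsGeneralizedPolygon m := by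
  have short : ∀ x a b : V, Γ.Adj a b → ∃ j : ℤ, |j| ≤ m ∧
      HasPosition 𝒜 m a b x j ∧ ∃ p : Γ.Walk x a, p.length = |j| := by
    intro x a b hab
    obtain ⟨A, hA, h1, h2⟩ := h.exists_apartment_adj_mem (v := x) hab
    obtain ⟨l, hl, rfl, rfl⟩ := h.exists_labelling hm hA h1
    obtain ⟨j, rfl⟩ := (hl.mem_iff x).1 h2
    -- The shorter way round the circuit.
    obtain ⟨j', hj', hl'⟩ : ∃ j' : ℤ, |j'| ≤ m ∧ l j = l j' := by
      have hp : (0 : ℤ) < 2 * m := by omega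
      have e1 := Int.emod_lt_of_pos j hp
      have e2 := Int.emod_nonneg j hp.ne'
      by_cases hc : j % (2 * m) ≤ m
      · exact ⟨j % (2 * m), by rw [abs_le]; omega, (hl.eq_iff _ _).2 (Int.dvd_self_sub_emod)⟩
      · refine ⟨j % (2 * m) - 2 * m, by rw [abs_le]; omega, (hl.eq_iff _ _).2 ?_⟩
        rw [← sub_add]
        exact dvd_add Int.dvd_self_sub_emod dvd_rfl
    rw [hl']
    refine ⟨j', hj', ⟨A, hA, l, hl, rfl, rfl, rfl⟩, ?_⟩
    rcases le_total 0 j' with hs | hs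
    · obtain ⟨p, hp⟩ := hl.exists_walk 0 j'.toNat
      refine ⟨(p.copy rfl ?_).reverse, ?_⟩
      · rw [Int.toNat_of_nonneg hs]; simp
      · simp [hp, abs_of_nonneg hs, hs]
    · obtain ⟨p, hp⟩ := hl.exists_walk j' (-j').toNat
      refine ⟨p.copy rfl ?_, ?_⟩
      · rw [Int.toNat_of_nonneg (by omega)]; simp
      · simp [hp, abs_of_nonpos hs, hs]
  have conn : Γ.Connected := by
    refine SimpleGraph.Connected.mk fun x y => ?_
    obtain ⟨b, hb⟩ := hnb y
    obtain ⟨j, -, -, p, -⟩ := short x y b hb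
    exact p.reachable
  refine ⟨conn, fun x y => ?_, ?_⟩
  · obtain ⟨b, hb⟩ := hnb y
    obtain ⟨j, h1, -, p, h2⟩ := short x y b hb
    have := SimpleGraph.dist_le p
    omega
  · intro x y a b hlt hya hyb ha hb
    by_contra hab
    obtain ⟨j, hj, hjpos, p, hp⟩ := short x y a hya
    obtain ⟨A, hA, h1, h2⟩ := h.exists_apartment_adj_adj hya hyb
    obtain ⟨l, hl, rfl, rfl⟩ := h.exists_labelling hm hA h1
    have hb' : b = l (-1) := by
      rcases (hl.adj_iff _ _).1 h2 with e | e
      · exact absurd e.symm (by simpa using hab)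
      · simpa using e
    have hp0 : HasPosition 𝒜 m (l 0) (l 1) (l 0) 0 := ⟨A, hA, l, hl, rfl, rfl, rfl⟩
    have hp1 : HasPosition 𝒜 m (l 0) (l 1) (l 1) 1 := ⟨A, hA, l, hl, rfl, rfl, rfl⟩
    have hp2 : HasPosition 𝒜 m (l 0) (l 1) b (-1) := ⟨A, hA, l, hl, rfl, rfl, hb'.symm⟩
    have main : ∀ v i, HasPosition 𝒜 m (l 0) (l 1) v i →
        ∃ z : ℤ, |z| ≤ Γ.dist x v ∧ (2 * m : ℤ) ∣ (j - i) - z := by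
      intro v i hv
      obtain ⟨q, hq⟩ := conn.exists_walk_length_eq_dist v x
      obtain ⟨z, hz⟩ := h.exists_dvd_of_walk hm hya q hv hjpos
      exact ⟨z, by rw [SimpleGraph.dist_comm, ← hq]; exact hz.1, hz.2⟩
    obtain ⟨z0, hz0, hd0⟩ := main _ _ hp0
    obtain ⟨z1, hz1, hd1⟩ := main _ _ hp1
    obtain ⟨z2, hz2, hd2⟩ := main _ _ hp2
    have hdj := SimpleGraph.dist_le p
    -- Both integers are small enough for congruence modulo `2 * m` to become equality; here `Γ.dist
    -- x y < m` is used.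
    have e0 := Int.abs_le_of_dvd_sub hd0 (by rw [sub_zero]; omega)
    rw [sub_zero] at e0
    subst e0
    have b1 : |j - 1| ≤ |j| + 1 := by simpa using abs_sub j 1
    have b2 : |j - (-1)| ≤ |j| + 1 := by simpa using abs_sub j (-1)
    have e1 := Int.abs_le_of_dvd_sub hd1 (by omega)
    have e2 := Int.abs_le_of_dvd_sub hd2 (by omega)
    rw [← e1] at hz1
    rw [← e2] at hz2
    have c1 := abs_le.1 hz1
    have c2 := abs_le.1 hz2
    have c3 : (Γ.dist x (l 0) : ℤ) ≤ |j| := by omega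
    rcases abs_cases j with ⟨hh, _⟩ | ⟨hh, _⟩ <;> omega

/-! ### Projections between opposite vertices -/

namespace SimpleGraph

variable {V : Type*} {G : SimpleGraph V} {m : ℕ}

theorem Coloring.even_walk_length_iff (c : G.Coloring (Fin 2)) {x y : V} (p : G.Walk x y) :
    Even p.length ↔ c x = c y := by
  induction p with
  | nil => simp
  | cons h p ih =>
    have := c.valid h
    rw [Walk.length_cons, Nat.even_add_one, ih]
    omega

theorem Coloring.even_dist_iff (c : G.Coloring (Fin 2)) (hG : G.Connected) (x y : V) :
    Even (G.dist x y) ↔ c x = c y := by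
  obtain ⟨p, hp⟩ := hG.exists_walk_length_eq_dist x y
  rw [← hp, c.even_walk_length_iff]

theorem Coloring.dist_adj (c : G.Coloring (Fin 2)) (hG : G.Connected) (x : V) {y z : V}
    (h : G.Adj y z) : G.dist x z = G.dist x y + 1 ∨ G.dist x y = G.dist x z + 1 := by
  have h1 := hG.dist_triangle (u := x) (v := y) (w := z)
  have h2 := hG.dist_triangle (u := x) (v := z) (w := y)
  rw [dist_eq_one_iff_adj.2 h] at h1
  rw [dist_eq_one_iff_adj.2 h.symm] at h2
  have h3 : G.dist x z ≠ G.dist x y := by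
    intro e
    have h4 := c.even_dist_iff hG x y
    have h5 := c.even_dist_iff hG x z
    have := c.valid h
    rw [e] at h5
    have h6 := h4.symm.trans h5
    omega
  omega

namespace IsGeneralizedPolygon

variable (hG : G.IsGeneralizedPolygon m) (c : G.Coloring (Fin 2))

include hG

theorem dist_le_succ (x : V) {y z : V} (h : G.Adj y z) : G.dist x z ≤ G.dist x y + 1 := by
  have h1 := hG.connected.dist_triangle (u := x) (v := y) (w := z)
  rwa [dist_eq_one_iff_adj.2 h] at h1

include c

theorem even_pred_iff (hm : 3 ≤ m) {x y o : V} (h : G.dist x y = m) (ho : G.Adj x o) :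
    Even (m - 1) ↔ c o = c y := by
  have h1 := c.even_dist_iff hG.connected x y
  have h2 := c.valid ho
  have h3 : Even m ↔ ¬Even (m - 1) := by rw [← Nat.even_add_one, Nat.sub_add_cancel (by omega)]
  rw [h, h3] at h1
  by_cases he : Even (m - 1)
  · simp only [he, not_true_eq_false, false_iff, true_iff] at h1 ⊢
    omega
  · simp only [he, not_false_eq_true, true_iff, false_iff] at h1 ⊢
    omega

/-- Parity leaves only `k ± 1`, and below the diameter `f` is the only neighbour of `y` nearer to
`x`. -/
theorem dist_eq_succ {x y f n : V} {k : ℕ} (hk : k < m) (hy : G.dist x y = k) (hf : G.Adj y f)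
    (hxf : G.dist x f < k) (hn : G.Adj y n) (hnf : n ≠ f) : G.dist x n = k + 1 := by
  rcases c.dist_adj hG.connected x hn with h | h
  · omega
  · exact absurd (hG.eq_of_dist_lt x y n f (by omega) hn hf (by omega) (by omega)) hnf

omit c in
theorem dist_pred_eq {x u o e : V} (hm : 3 ≤ m) (h : G.dist x u = m) (ho : G.Adj x o)
    (he : G.Adj u e) (hoe : G.dist o e ≤ m - 2) : G.dist e x = m - 1 ∧ G.dist e o ≤ m - 2 := by
  have h1 := hG.dist_le_succ x he.symm
  have h2 := hG.dist_le_succ e ho.symm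
  rw [dist_comm (u := e) (v := o)] at *
  rw [dist_comm (u := x) (v := e)] at h1
  omega

omit c in
-- For opposite `x`, `u`, the relation `dist o e ≤ m - 2` is projection between their neighbours:
-- `e` has distance `m - 1` from `x`, and `o` is the unique first vertex on the way from `x` to `e`.
theorem eq_of_opposite {x u o o' e : V} (hm : 3 ≤ m) (h : G.dist x u = m) (ho : G.Adj x o)
    (ho' : G.Adj x o') (he : G.Adj u e) (hoe : G.dist o e ≤ m - 2) (hoe' : G.dist o' e ≤ m - 2) :
    o = o' := by
  obtain ⟨h1, h2⟩ := hG.dist_pred_eq hm h ho he hoe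
  obtain ⟨-, h3⟩ := hG.dist_pred_eq hm h ho' he hoe'
  exact hG.eq_of_dist_lt e x o o' (by omega) ho ho' (by omega) (by omega)

omit c in
theorem eq_iff_of_opposite {x u o o' e e' : V} (hm : 3 ≤ m) (h : G.dist x u = m) (ho : G.Adj x o)
    (ho' : G.Adj x o') (he : G.Adj u e) (he' : G.Adj u e') (hoe : G.dist o e ≤ m - 2)
    (hoe' : G.dist o' e' ≤ m - 2) : o = o' ↔ e = e' := by
  constructor
  · rintro rfl
    rw [dist_comm] at h hoe hoe'
    exact hG.eq_of_opposite hm h he he' ho hoe hoe'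
  · rintro rfl
    exact hG.eq_of_opposite hm h ho ho' he hoe hoe'

/-- Neighbours not matched by the projection are opposite, since leaving `x` away from `q` lengthens
the geodesic to `e`. -/
theorem dist_eq_of_ne_pred {x u o q e : V} (hm : 3 ≤ m) (h : G.dist x u = m) (ho : G.Adj x o)
    (hq : G.Adj x q) (hqo : q ≠ o) (he : G.Adj u e) (hqe : G.dist q e ≤ m - 2) :
    G.dist o e = m := by
  obtain ⟨h1, h2⟩ := hG.dist_pred_eq hm h hq he hqe
  rw [dist_comm, hG.dist_eq_succ c (by omega) h1 hq (by omega) ho hqo.symm]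
  omega

/-- The projection is the second vertex of a geodesic from `u` to `o`. -/
theorem exists_pred {x u o : V} (hm : 3 ≤ m) (h : G.dist x u = m) (ho : G.Adj x o) :
    ∃ e, G.Adj u e ∧ G.dist o e ≤ m - 2 := by
  have h1 : G.dist o u ≤ m - 1 := by
    have h2 := c.dist_adj hG.connected u ho
    rw [dist_comm (u := u), dist_comm (u := u), h] at h2
    have := hG.dist_le o u
    omega
  have h2 : 0 < G.dist o u := by
    have := hG.dist_le_succ u ho.symm
    rw [dist_comm, h, dist_comm] at this
    omega
  obtain ⟨p, hp⟩ := hG.connected.exists_walk_length_eq_dist u o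
  cases p with
  | nil => simp at h2
  | cons hadj p =>
    refine ⟨_, hadj, ?_⟩
    have := SimpleGraph.dist_le p
    rw [Walk.length_cons] at hp
    rw [dist_comm] at h1
    rw [dist_comm]
    omega

theorem encard_neighborSet_le {x u : V} (hm : 3 ≤ m) (h : G.dist x u = m) :
    (G.neighborSet x).encard ≤ (G.neighborSet u).encard := by
  classical
  have : ∀ o, ∃ e, G.Adj x o → G.Adj u e ∧ G.dist o e ≤ m - 2 := fun o => by
    by_cases ho : G.Adj x o
    · obtain ⟨e, he⟩ := hG.exists_pred c hm h ho
      exact ⟨e, fun _ => he⟩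
    · exact ⟨x, fun h => absurd h ho⟩
  choose f hf using this
  refine Set.encard_le_encard_of_injOn (f := f) (fun o ho => (hf o ho).1) fun o ho o' ho' e => ?_
  exact (hG.eq_iff_of_opposite hm h ho ho' (hf o ho).1 (hf o' ho').1 (hf o ho).2 (hf o' ho').2).2 e

theorem encard_neighborSet_eq {x u : V} (hm : 3 ≤ m) (h : G.dist x u = m) :
    (G.neighborSet x).encard = (G.neighborSet u).encard :=
  (hG.encard_neighborSet_le c hm h).antisymm (hG.encard_neighborSet_le c hm (dist_comm ▸ h))

end IsGeneralizedPolygon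

/-! ### Semicontinuity of the distance -/

section Topology

variable [TopologicalSpace V] [CompactSpace V] [T2Space V]

/-- In a compact Hausdorff space the composition of two closed relations is closed: the middle
vertex is projected away from a compact set. -/
theorem isClosed_setOf_walk_length (h : IsClosed {p : V × V | G.Adj p.1 p.2}) (k : ℕ) :
    IsClosed {p : V × V | ∃ w : G.Walk p.1 p.2, w.length = k} := by
  induction k with
  | zero =>
    convert isClosed_diagonal (X := V) using 1
    ext ⟨x, y⟩
    constructor
    · rintro ⟨w, hw⟩; exact Walk.eq_of_length_eq_zero hw
    · rintro (rfl : x = y); exact ⟨Walk.nil, rfl⟩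
  | succ k ih =>
    have hc : IsClosed {q : (V × V) × V | (G.Adj q.1.1 q.2) ∧
        ∃ w : G.Walk q.2 q.1.2, w.length = k} :=
      (h.preimage (f := fun q : (V × V) × V => (q.1.1, q.2)) (by fun_prop)).inter
        (ih.preimage (f := fun q : (V × V) × V => (q.2, q.1.2)) (by fun_prop))
    convert (hc.isCompact.image continuous_fst).isClosed using 1
    ext ⟨x, y⟩
    constructor
    · rintro ⟨w, hw⟩
      cases w with
      | nil => simp at hw
      | cons hadj w => exact ⟨((x, y), _), ⟨hadj, w, by simpa using hw⟩, rfl⟩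
    · rintro ⟨⟨⟨x', y'⟩, z⟩, ⟨hadj, w, hw⟩, e⟩
      simp only [Prod.mk.injEq] at e
      obtain ⟨rfl, rfl⟩ := e
      exact ⟨Walk.cons hadj w, by simpa using hw⟩

/-- This gives both the openness of opposition and the continuity of projections. -/
theorem Connected.isClosed_setOf_dist_le (hG : G.Connected)
    (h : IsClosed {p : V × V | G.Adj p.1 p.2}) (k : ℕ) :
    IsClosed {p : V × V | G.dist p.1 p.2 ≤ k} := by
  have : {p : V × V | G.dist p.1 p.2 ≤ k} =
      ⋃ j ∈ Set.Iic k, {p : V × V | ∃ w : G.Walk p.1 p.2, w.length = j} := by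
    ext p
    simp only [Set.mem_ofPred_eq, Set.mem_iUnion, Set.mem_Iic, exists_prop]
    constructor
    · intro hp
      exact ⟨_, hp, hG.exists_walk_length_eq_dist _ _⟩
    · rintro ⟨j, hj, w, hw⟩
      exact (dist_le w).trans (hw ▸ hj)
  rw [this]
  exact (Set.finite_Iic k).isClosed_biUnion fun j _ => isClosed_setOf_walk_length h j

end Topology

end SimpleGraph

/-- A closed relation in a compact space that is single-valued at a point is continuous there. -/
theorem IsClosed.exists_nhds_of_forall_eq {X Y : Type*} [TopologicalSpace X] [TopologicalSpace Y]
    [CompactSpace X] [T2Space X] [CompactSpace Y] {K : Set (X × Y)} (hK : IsClosed K) {x : X}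
    {y : Y} (hxy : ∀ y', (x, y') ∈ K → y' = y) {N : Set Y} (hN : N ∈ 𝓝 y) :
    ∃ M ∈ 𝓝 x, ∀ x' ∈ M, ∀ y', (x', y') ∈ K → y' ∈ N := by
  have hc : IsClosed (Prod.fst '' (K ∩ Prod.snd ⁻¹' (interior N)ᶜ)) :=
    ((hK.inter (isOpen_interior.isClosed_compl.preimage continuous_snd)).isCompact.image
      continuous_fst).isClosed
  refine ⟨_, hc.isOpen_compl.mem_nhds ?_, ?_⟩
  · rintro ⟨⟨x', y'⟩, ⟨h1, h2⟩, rfl : x' = x⟩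
    exact h2 (hxy y' h1 ▸ mem_interior_iff_mem_nhds.2 hN)
  · intro x' hx' y' hy'
    by_contra hy
    exact hx' ⟨(x', y'), ⟨hy', fun h => hy (interior_subset h)⟩, rfl⟩

/-! ### Simultaneous projections for two homomorphisms -/

/-- Two homomorphisms `s`, `t` from a graph `H`, in which vertices can be joined by walks of all
lengths permitted by a polygon, onto one compact generalized polygon `G`. -/
structure ResiduePair {V W : Type*} [TopologicalSpace V] (G : SimpleGraph V)
    (c : G.Coloring (Fin 2)) (m : ℕ) (H : SimpleGraph W) (s t : W → V) : Prop where
  polygon : G.IsGeneralizedPolygon m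
  three_le : 3 ≤ m
  isClosed_adj : IsClosed {p : V × V | G.Adj p.1 p.2}
  adj_left : ∀ {x y}, H.Adj x y → G.Adj (s x) (s y)
  adj_right : ∀ {x y}, H.Adj x y → G.Adj (t x) (t y)
  color_eq : ∀ x, c (s x) = c (t x)
  surjective_left : Function.Surjective s
  surjective_right : Function.Surjective t
  exists_walk : ∀ k x y, m - 1 ≤ k → (Even k ↔ c (s x) = c (s y)) → ∃ w : H.Walk x y, w.length = k

theorem SimpleGraph.exists_walk_concat {W : Type*} {H : SimpleGraph W} {k : ℕ} {x y : W}
    (w : H.Walk x y) (hw : w.length = k + 1) :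
    ∃ e, H.Adj y e ∧ ∃ w' : H.Walk x e, w'.length = k := by
  have hr : w.reverse.length = k + 1 := by simpa using hw
  generalize w.reverse = r at hr
  cases r with
  | nil => simp at hr
  | cons h r => exact ⟨_, h, r.reverse, by simpa using hr⟩

namespace ResiduePair

variable {V W : Type*} [TopologicalSpace V] {G : SimpleGraph V}
  {c : G.Coloring (Fin 2)} {m : ℕ} {H : SimpleGraph W} {s t : W → V}

section Defs

variable (G H s t)

/-- `x` and `y` have distance `k` in both images. -/
def BiDist (x y : W) (k : ℕ) : Prop := G.dist (s x) (s y) = k ∧ G.dist (t x) (t y) = k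

/-- `x` and `y` have distance at most `k` in both images. -/
def BiLe (x y : W) (k : ℕ) : Prop := G.dist (s x) (s y) ≤ k ∧ G.dist (t x) (t y) ≤ k

/-- Any two neighbours of `v` can be separated in both images from a third one. -/
def Separated (v : W) : Prop :=
  ∀ o o', H.Adj v o → H.Adj v o' →
    ∃ q, H.Adj v q ∧ (s q ≠ s o ∧ t q ≠ t o) ∧ (s q ≠ s o' ∧ t q ≠ t o')

/-- `v` has separated neighbours, and a vertex opposite to it in both images. -/
def Good (m : ℕ) (v : W) : Prop := Separated H s t v ∧ ∃ u, BiDist G s t v u m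

/-- The neighbour `v` of `n` is identified by `s`, but not by `t`, with another neighbour. -/
def Splits (n v : W) : Prop := ∃ x, H.Adj n x ∧ s x = s v ∧ t x ≠ t v

/-- There are neighbours of `n` distinguished by `s` from `v`, but arbitrarily close to `v`
with respect to `t`. -/
def Merges (n v : W) : Prop :=
  ∀ N ∈ 𝓝 (t v), ∃ y, H.Adj n y ∧ s y ≠ s v ∧ t y ∈ N

/-- The property `P` of pairs of adjacent vertices is invariant under projection between
vertices that are opposite in both images. -/
def Transports (m : ℕ) (P : W → W → Prop) : Prop :=
  ∀ {n v w e}, P n v → H.Adj n v → BiDist G s t n w m → H.Adj w e → BiLe G s t v e (m - 2) → P w e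

end Defs

omit [TopologicalSpace V] in
theorem BiDist.symm {x y : W} {k : ℕ} (h : BiDist G s t x y k) : BiDist G s t y x k :=
  ⟨by rw [SimpleGraph.dist_comm]; exact h.1, by rw [SimpleGraph.dist_comm]; exact h.2⟩

omit [TopologicalSpace V] in
theorem BiLe.symm {x y : W} {k : ℕ} (h : BiLe G s t x y k) : BiLe G s t y x k :=
  ⟨by rw [SimpleGraph.dist_comm]; exact h.1, by rw [SimpleGraph.dist_comm]; exact h.2⟩

omit [TopologicalSpace V] in
theorem Good.symm {v : W} (h : Good G H s t m v) : Good G H t s m v := by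
  obtain ⟨h1, u, h2⟩ := h
  refine ⟨fun o o' ho ho' => ?_, u, h2.2, h2.1⟩
  obtain ⟨q, hq, h3, h4⟩ := h1 o o' ho ho'
  exact ⟨q, hq, h3.symm, h4.symm⟩

variable (R : ResiduePair G c m H s t)

include R

theorem symm : ResiduePair G c m H t s where
  polygon := R.polygon
  three_le := R.three_le
  isClosed_adj := R.isClosed_adj
  adj_left := R.adj_right
  adj_right := R.adj_left
  color_eq x := (R.color_eq x).symm
  surjective_left := R.surjective_right
  surjective_right := R.surjective_left
  exists_walk k x y hk h := R.exists_walk k x y hk (by rw [R.color_eq, R.color_eq]; exact h)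

theorem biLe_of_walk {x y : W} (w : H.Walk x y) : BiLe G s t x y w.length := by
  induction w with
  | nil => simp [BiLe]
  | @cons a b d h w ih =>
    rw [SimpleGraph.Walk.length_cons]
    have h1 := R.polygon.connected.dist_triangle (u := s a) (v := s b) (w := s d)
    have h2 := R.polygon.connected.dist_triangle (u := t a) (v := t b) (w := t d)
    rw [SimpleGraph.dist_eq_one_iff_adj.2 (R.adj_left h)] at h1
    rw [SimpleGraph.dist_eq_one_iff_adj.2 (R.adj_right h)] at h2
    exact ⟨by have := ih.1; omega, by have := ih.2; omega⟩

theorem biDist_one {x y : W} (h : H.Adj x y) : BiDist G s t x y 1 :=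
  ⟨SimpleGraph.dist_eq_one_iff_adj.2 (R.adj_left h),
    SimpleGraph.dist_eq_one_iff_adj.2 (R.adj_right h)⟩

/-- The last vertex but one of a single walk of length `m - 1` in `H` serves as a projection in both
images. -/
theorem exists_proj {x y : W} (h : Even (m - 1) ↔ c (s x) = c (s y)) :
    ∃ e, H.Adj y e ∧ BiLe G s t x e (m - 2) := by
  obtain ⟨w, hw⟩ := R.exists_walk (m - 1) x y le_rfl h
  have hm := R.three_le
  obtain ⟨e, he, w', hw'⟩ := SimpleGraph.exists_walk_concat (k := m - 2) w (by omega)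
  exact ⟨e, he, hw' ▸ R.biLe_of_walk w'⟩

theorem exists_persp {v w o : W} (h : BiDist G s t v w m) (ho : H.Adj v o) :
    ∃ e, H.Adj w e ∧ BiLe G s t o e (m - 2) :=
  R.exists_proj (R.polygon.even_pred_iff c R.three_le h.1 (R.adj_left ho))

theorem persp_iff {v w o o' e e' : W} (h : BiDist G s t v w m) (ho : H.Adj v o)
    (ho' : H.Adj v o') (he : H.Adj w e) (he' : H.Adj w e') (h1 : BiLe G s t o e (m - 2))
    (h2 : BiLe G s t o' e' (m - 2)) : s o = s o' ↔ s e = s e' :=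
  R.polygon.eq_iff_of_opposite R.three_le h.1 (R.adj_left ho) (R.adj_left ho') (R.adj_left he)
    (R.adj_left he') h1.1 h2.1

theorem persp_iff' {v w o o' e e' : W} (h : BiDist G s t v w m) (ho : H.Adj v o)
    (ho' : H.Adj v o') (he : H.Adj w e) (he' : H.Adj w e') (h1 : BiLe G s t o e (m - 2))
    (h2 : BiLe G s t o' e' (m - 2)) : t o = t o' ↔ t e = t e' :=
  R.polygon.eq_iff_of_opposite R.three_le h.2 (R.adj_right ho) (R.adj_right ho') (R.adj_right he)
    (R.adj_right he') h1.2 h2.2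

theorem separated_of_biDist {v w : W} (h : BiDist G s t v w m) (hv : Separated H s t v) :
    Separated H s t w := by
  intro e e' he he'
  obtain ⟨o, ho, h1⟩ := R.exists_persp h.symm he
  obtain ⟨o', ho', h2⟩ := R.exists_persp h.symm he'
  obtain ⟨q, hq, h3, h4⟩ := hv o o' ho ho'
  obtain ⟨r, hr, h5⟩ := R.exists_persp h hq
  have h1 := h1.symm
  have h2 := h2.symm
  exact ⟨r, hr, ⟨mt (R.persp_iff h hq ho hr he h5 h1).2 h3.1,
    mt (R.persp_iff' h hq ho hr he h5 h1).2 h3.2⟩, ⟨mt (R.persp_iff h hq ho' hr he' h5 h2).2 h4.1,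
    mt (R.persp_iff' h hq ho' hr he' h5 h2).2 h4.2⟩⟩

/-- A neighbour `q` separated from both `o` and `o'` is projected to `u`; the result is opposite to
every neighbour not matched with `q`. -/
theorem exists_common_opposite {v o o' : W} (hv : Good G H s t m v) (ho : H.Adj v o)
    (ho' : H.Adj v o') :
    ∃ e, BiDist G s t o e m ∧ BiDist G s t o' e m ∧ BiDist G s t v e (m - 1) := by
  obtain ⟨hs, u, hu⟩ := hv
  obtain ⟨q, hq, h1, h2⟩ := hs o o' ho ho'
  obtain ⟨e, he, hqe⟩ := R.exists_persp hu hq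
  have := R.three_le
  exact ⟨e,
    ⟨R.polygon.dist_eq_of_ne_pred c this hu.1 (R.adj_left ho) (R.adj_left hq) h1.1 (R.adj_left he)
      hqe.1,
    R.polygon.dist_eq_of_ne_pred c this hu.2 (R.adj_right ho) (R.adj_right hq) h1.2
      (R.adj_right he) hqe.2⟩,
    ⟨R.polygon.dist_eq_of_ne_pred c this hu.1 (R.adj_left ho') (R.adj_left hq) h2.1 (R.adj_left he)
      hqe.1,
    R.polygon.dist_eq_of_ne_pred c this hu.2 (R.adj_right ho') (R.adj_right hq) h2.2
      (R.adj_right he) hqe.2⟩,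
    BiDist.symm ⟨(R.polygon.dist_pred_eq this hu.1 (R.adj_left hq) (R.adj_left he) hqe.1).1,
      (R.polygon.dist_pred_eq this hu.2 (R.adj_right hq) (R.adj_right he) hqe.2).1⟩⟩

/-- Separation is carried by projection from `o'` to a common opposite `e`, and from `e` to `o`. -/
theorem good_of_adj {v o o' : W} (hv : Good G H s t m v) (ho : H.Adj v o) (ho' : H.Adj v o')
    (h : Good G H s t m o') : Good G H s t m o := by
  obtain ⟨e, h1, h2, -⟩ := R.exists_common_opposite hv ho ho'
  exact ⟨R.separated_of_biDist h1.symm (R.separated_of_biDist h2 h.1), e, h1⟩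

theorem exists_walk_to (x y : W) : Nonempty (H.Walk x y) := by
  by_cases h : (Even m ↔ c (s x) = c (s y))
  · obtain ⟨w, -⟩ := R.exists_walk m x y (by omega) h
    exact ⟨w⟩
  · obtain ⟨w, -⟩ := R.exists_walk (m + 1) x y (by omega) (by rw [Nat.even_add_one]; tauto)
    exact ⟨w⟩

theorem good_of_good {p q : W} (hpq : H.Adj p q) (hp : Good G H s t m p) (hq : Good G H s t m q)
    (x : W) : Good G H s t m x := by
  obtain ⟨w⟩ := R.exists_walk_to p x
  suffices h : ∀ {a b : W} (w : H.Walk a b), (Good G H s t m a ∧ ∃ a', H.Adj a a' ∧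
      Good G H s t m a') → Good G H s t m b from h w ⟨hp, q, hpq, hq⟩
  intro a b w
  induction w with
  | nil => exact fun h => h.1
  | cons h w ih =>
    rintro ⟨ha, a', haa', ha'⟩
    exact ih ⟨R.good_of_adj ha h haa' ha', _, h.symm, ha⟩

/-- An arbitrary preimage of `x` need not be adjacent to `v`; projecting it to the opposite `u` and
back to `v` corrects this without changing its image. -/
theorem exists_lift {v : W} (hv : Good G H s t m v) {x : V} (hx : G.Adj (s v) x) :
    ∃ y, H.Adj v y ∧ s y = x := by
  obtain ⟨-, u, hu⟩ := hv
  obtain ⟨x', rfl⟩ := R.surjective_left x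
  obtain ⟨e, he, h1⟩ := R.exists_proj (R.polygon.even_pred_iff c R.three_le hu.1 hx)
  obtain ⟨y, hy, h2⟩ := R.exists_persp hu.symm he
  refine ⟨y, hy, ?_⟩
  exact R.polygon.eq_of_opposite R.three_le hu.1 (R.adj_left hy) hx (R.adj_left he) h2.symm.1 h1.1

theorem transports_splits : Transports G H s t m (Splits H s t) := by
  rintro n v w e ⟨x, hx, h1, h2⟩ hv hn he h3
  obtain ⟨y, hy, h4⟩ := R.exists_persp hn hx
  exact ⟨y, hy, (R.persp_iff hn hx hv hy he h4 h3).1 h1,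
    mt (R.persp_iff' hn hx hv hy he h4 h3).2 h2⟩

theorem biDist_succ {x y f n : W} {k : ℕ} (hk : k < m) (hy : BiDist G s t x y k) (hf : H.Adj y f)
    (hxf : BiLe G s t x f (k - 1)) (hk0 : 0 < k) (hn : H.Adj y n) (hnf : s n ≠ s f ∧ t n ≠ t f) :
    BiDist G s t x n (k + 1) :=
  ⟨R.polygon.dist_eq_succ c hk hy.1 (R.adj_left hf) (by have := hxf.1; omega) (R.adj_left hn) hnf.1,
    R.polygon.dist_eq_succ c hk hy.2 (R.adj_right hf) (by have := hxf.2; omega) (R.adj_right hn)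
      hnf.2⟩

/-- Two neighbours of a vertex have extensions to the same vertex at distance `m - 1`. -/
theorem exists_common_extension (hgood : ∀ v, Good G H s t m v) {p o o' : W} (ho : H.Adj p o)
    (ho' : H.Adj p o') : ∃ f y, H.Adj f y ∧
      BiDist G s t o f (m - 2) ∧ BiDist G s t o' f (m - 2) ∧
      BiDist G s t o y (m - 1) ∧ BiDist G s t o' y (m - 1) ∧ BiLe G s t p y (m - 2) := by
  have hm := R.three_le
  -- The paths from `o` and `o'` meet at `p` and continue together, each time to a neighbour
  -- separated from the preceding vertex.
  have key : ∀ j, j + 3 ≤ m → ∃ f y, H.Adj f y ∧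
      BiDist G s t o f (j + 1) ∧ BiDist G s t o' f (j + 1) ∧
      BiDist G s t o y (j + 2) ∧ BiDist G s t o' y (j + 2) ∧ BiLe G s t p y (j + 1) := by
    intro j
    induction j with
    | zero =>
      intro _
      obtain ⟨q, hq, h1, h2⟩ := (hgood p).1 o o' ho ho'
      refine ⟨p, q, hq, R.biDist_one ho.symm, R.biDist_one ho'.symm, ?_, ?_,
        (R.biDist_one hq).1.le, (R.biDist_one hq).2.le⟩
      · exact R.biDist_succ (by omega) (R.biDist_one ho.symm) ho (by simp [BiLe]) one_pos hq h1
      · exact R.biDist_succ (by omega) (R.biDist_one ho'.symm) ho' (by simp [BiLe]) one_pos hq h2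
    | succ j ih =>
      intro hj
      obtain ⟨f, y, hfy, h1, h2, h3, h4, h5⟩ := ih (by omega)
      obtain ⟨n, hn, h6, -⟩ := (hgood y).1 f f hfy.symm hfy.symm
      refine ⟨y, n, hn, h3, h4, ?_, ?_, ?_⟩
      · exact R.biDist_succ (by omega) h3 hfy.symm ⟨h1.1.le, h1.2.le⟩ (by omega) hn h6
      · exact R.biDist_succ (by omega) h4 hfy.symm ⟨h2.1.le, h2.2.le⟩ (by omega) hn h6
      · exact ⟨(R.polygon.dist_le_succ _ (R.adj_left hn)).trans (by have := h5.1; omega),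
          (R.polygon.dist_le_succ _ (R.adj_right hn)).trans (by have := h5.2; omega)⟩
  obtain ⟨k, rfl⟩ : ∃ k, m = k + 3 := ⟨m - 3, by omega⟩
  exact key k le_rfl

/-- Chains of projections reach all adjacent pairs whose second vertex has the colour of `v`. -/
theorem transport_all (hgood : ∀ v, Good G H s t m v) {P : W → W → Prop}
    (hP : Transports G H s t m P) {n v : W} (hnv : H.Adj n v) (h : P n v) {n' v' : W}
    (hnv' : H.Adj n' v') (hc : c (s v') = c (s v)) : P n' v' := by
  have hm := R.three_le
  -- `v` projects to a neighbour of a common opposite of `n` and `n'`, and from there back to `v`.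
  have change : ∀ {v n n'}, H.Adj v n → H.Adj v n' → P n v → P n' v := by
    intro v n n' hn hn' h
    obtain ⟨e, h1, h2, h3⟩ := R.exists_common_opposite (hgood v) hn hn'
    obtain ⟨f, hf, h4⟩ := R.exists_persp h1 hn.symm
    exact hP (hP h hn.symm h1 hf h4) hf h2.symm hn'.symm h4.symm
  -- Neighbours `k` of `o` and `k'` of `o'` off `p` are both opposite to `y`, and `o`, `o'` both
  -- project to `f`.
  have two : ∀ {p o o' n n'}, H.Adj p o → H.Adj p o' → H.Adj o n → H.Adj o' n' → P n o →
      P n' o' := by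
    intro p o o' n n' ho ho' hn hn' h
    obtain ⟨f, y, hfy, h1, h2, h3, h4, h5⟩ := R.exists_common_extension hgood ho ho'
    have ext : ∀ {o}, H.Adj p o → BiDist G s t o y (m - 1) → ∃ n, H.Adj o n ∧
        BiDist G s t n y m := by
      intro o ho h
      obtain ⟨n, hn, hnp, -⟩ := (hgood o).1 p p ho.symm ho.symm
      have := R.biDist_succ (by omega) h.symm ho.symm
        ⟨h5.symm.1.trans (by omega), h5.symm.2.trans (by omega)⟩ (by omega) hn hnp
      rw [Nat.sub_add_cancel (by omega)] at this
      exact ⟨n, hn, this.symm⟩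
    obtain ⟨k, hk, hk1⟩ := ext ho h3
    obtain ⟨k', hk', hk1'⟩ := ext ho' h4
    have e1 : P y f := hP (change hn hk h) hk.symm hk1 hfy.symm ⟨h1.1.le, h1.2.le⟩
    have e2 : P k' o' := hP e1 hfy.symm hk1'.symm hk'.symm ⟨h2.symm.1.le, h2.symm.2.le⟩
    exact change hk' hn' e2
  -- The invariant carried along a walk: at vertices of the colour of `v` it concerns the vertex
  -- itself, at the others all their neighbours.
  let Q : W → Prop := fun y => (c (s y) = c (s v) → ∀ n', H.Adj y n' → P n' y) ∧
    (c (s y) ≠ c (s v) → ∀ z, H.Adj y z → ∀ n', H.Adj z n' → P n' z)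
  have step : ∀ {y y'}, H.Adj y y' → Q y → Q y' := by
    intro y y' hy hQ
    have hne := c.valid (R.adj_left hy)
    refine ⟨fun h1 => ?_, fun h1 z hz n' hn' => ?_⟩
    · exact hQ.2 (by rw [← h1]; exact hne) y' hy
    · exact two hy.symm hz hy hn' (hQ.1 (by omega) y' hy)
  have walk : ∀ {a b} (_ : H.Walk a b), Q a → Q b := by
    intro a b w
    induction w with
    | nil => exact id
    | cons h w ih => exact fun hQ => ih (step h hQ)
  obtain ⟨w⟩ := R.exists_walk_to v v'
  have hQv : Q v := ⟨fun _ n' hn' => change hnv.symm hn' h, fun h1 => absurd rfl h1⟩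
  exact (walk w hQv).1 hc n' hnv'.symm

/-- The projection between opposite vertices is continuous. -/
theorem exists_nhds_persp [CompactSpace V] [T2Space V] {x u o e : V} (h : G.dist x u = m)
    (ho : G.Adj x o) (he : G.Adj u e) (hoe : G.dist o e ≤ m - 2) {N : Set V} (hN : N ∈ 𝓝 e) :
    ∃ M ∈ 𝓝 o, ∀ o' ∈ M, ∀ e', G.Adj u e' → G.dist o' e' ≤ m - 2 → e' ∈ N := by
  -- Points near `o` need not be adjacent to `x`: single-valuedness at `o` suffices.
  have hK : IsClosed {p : V × V | G.Adj u p.2 ∧ G.dist p.1 p.2 ≤ m - 2} :=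
    (R.isClosed_adj.preimage (f := fun p : V × V => (u, p.2)) (by fun_prop)).inter
      (R.polygon.connected.isClosed_setOf_dist_le R.isClosed_adj _)
  obtain ⟨M, hM, h1⟩ := hK.exists_nhds_of_forall_eq (x := o) (y := e) (fun e' he' =>
    ((R.polygon.eq_iff_of_opposite R.three_le h ho ho he'.1 he he'.2 hoe).1 rfl)) hN
  exact ⟨M, hM, fun o' ho' e' h2 h3 => h1 o' ho' e' ⟨h2, h3⟩⟩

theorem transports_merges [CompactSpace V] [T2Space V] :
    Transports G H s t m (Merges H s t) := by
  intro n v w e h hv hn he h3 N hN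
  obtain ⟨M, hM, h4⟩ := R.exists_nhds_persp hn.2 (R.adj_right hv) (R.adj_right he) h3.2 hN
  obtain ⟨y, hy, h5, h6⟩ := h M hM
  obtain ⟨z, hz, h7⟩ := R.exists_persp hn hy
  exact ⟨z, hz, mt (R.persp_iff hn hy hv hz he h7 h3).2 h5, h4 _ h6 _ (R.adj_right hz) h7.2⟩

end ResiduePair

/-! ### Splitting excludes merging -/

namespace ResiduePair

variable {V W : Type*} [TopologicalSpace V] {G : SimpleGraph V}
  {c : G.Coloring (Fin 2)} {m : ℕ} {H : SimpleGraph W} {s t : W → V}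
  (R : ResiduePair G c m H s t)

include R

/-- Starting with a splitting `x` of `b` at `p`, a vertex at different distances from the two
images of `p`. -/
theorem exists_skew_extension (hgood : ∀ v, Good G H s t m v) {p a b x : W} (ha : H.Adj p a)
    (hb : H.Adj p b) (hbx : H.Adj b x) (hs : s x = s p) (ht : t x ≠ t p) :
    ∃ e, G.dist (s a) (s e) = m - 2 ∧ G.dist (s p) (s e) ≤ m - 3 ∧
      G.dist (t p) (t e) = m - 1 ∧ G.dist (t b) (t e) ≤ m - 2 := by
  have hm := R.three_le
  -- Since `s x = s p` but `t x ≠ t p`, the vertex `x` is one step from `a` under `s` and two from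
  -- `p` under `t`. A path from `x` lengthens both distances, avoiding the predecessors `f` (for
  -- `s`) and `f'` (for `t`).
  have key : ∀ j, j + 3 ≤ m → ∃ e f f', H.Adj e f ∧ H.Adj e f' ∧
      G.dist (s a) (s f) = j ∧ G.dist (s a) (s e) = j + 1 ∧ G.dist (s p) (s e) ≤ j ∧
      G.dist (t p) (t f') = j + 1 ∧ G.dist (t p) (t e) = j + 2 ∧ G.dist (t b) (t e) ≤ j + 1 := by
    intro j
    induction j with
    | zero =>
      intro _
      obtain ⟨a', ha', e⟩ := R.exists_lift (hgood x) (x := s a) (by rw [hs]; exact R.adj_left ha)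
      refine ⟨x, a', b, ha', hbx.symm, by simp [e], ?_, by simp [hs],
        (R.biDist_one hb).2, ?_, (R.biDist_one hbx).2.le⟩
      · rw [hs]; exact (R.biDist_one ha.symm).1
      · exact R.polygon.dist_eq_succ c (by omega) (R.biDist_one hb).2 (R.adj_right hb.symm)
          (by simp) (R.adj_right hbx) ht
    | succ j ih =>
      intro hj
      obtain ⟨e, f, f', hf, hf', h1, h2, h3, h4, h5, h6⟩ := ih (by omega)
      obtain ⟨q, hq, h7, h8⟩ := (hgood e).1 f f' hf hf'
      refine ⟨q, e, e, hq.symm, hq.symm, h2, ?_, ?_, h5, ?_, ?_⟩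
      · exact R.polygon.dist_eq_succ c (by omega) h2 (R.adj_left hf) (by omega) (R.adj_left hq) h7.1
      · exact (R.polygon.dist_le_succ _ (R.adj_left hq)).trans (by omega)
      · exact R.polygon.dist_eq_succ c (by omega) h5 (R.adj_right hf') (by omega) (R.adj_right hq)
          h8.2
      · exact (R.polygon.dist_le_succ _ (R.adj_right hq)).trans (by omega)
  obtain ⟨k, rfl⟩ : ∃ k, m = k + 3 := ⟨m - 3, by omega⟩
  obtain ⟨e, f, f', -, -, -, h2, h3, -, h5, h6⟩ := key k le_rfl
  exact ⟨e, h2, h3, h5, h6⟩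

variable [CompactSpace V] [T2Space V]

/-- If no neighbour of `p` has the same image as `a` under `s` and an image close to that of `b`
under `t`, then `p` cannot split at `b` and merge at `a`. -/
theorem not_merges_of_splits (hgood : ∀ v, Good G H s t m v) {p a b : W} (ha : H.Adj p a)
    (hb : H.Adj p b) {N : Set V} (hN : N ∈ 𝓝 (t b)) (hab : ∀ z, H.Adj p z → s z = s a → t z ∉ N)
    (hsplit : Splits H s t b p) : ¬ Merges H s t a p := by
  intro hmerge
  have hm := R.three_le
  obtain ⟨x, hbx, hsx, htx⟩ := hsplit
  obtain ⟨e, e1, e2, e3, e4⟩ := R.exists_skew_extension hgood ha hb hbx hsx htx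
  -- The vertex `g` found below need not be adjacent to `p`; it will be projected to `w` and back.
  -- The neighbourhoods are chosen backwards along this route.
  obtain ⟨w, hw⟩ := (hgood p).2
  obtain ⟨r, hr, hbr⟩ := R.exists_persp hw hb
  obtain ⟨N₁, hN₁, k1⟩ := R.exists_nhds_persp hw.symm.2 (R.adj_right hr) (R.adj_right hb)
    hbr.symm.2 hN
  obtain ⟨N₂, hN₂, k2⟩ := R.exists_nhds_persp hw.2 (R.adj_right hb) (R.adj_right hr) hbr.2 hN₁
  -- At `t p` the only neighbour within `m - 2` of `t e` is `t b`.
  obtain ⟨M, hM, k3⟩ : ∃ M ∈ 𝓝 (t p), ∀ u ∈ M, ∀ g, G.Adj u g ∧ G.dist (t e) g ≤ m - 2 →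
      g ∈ N₂ := by
    have hK : IsClosed {q : V × V | G.Adj q.1 q.2 ∧ G.dist (t e) q.2 ≤ m - 2} :=
      R.isClosed_adj.inter ((R.polygon.connected.isClosed_setOf_dist_le R.isClosed_adj _).preimage
        (f := fun q : V × V => (t e, q.2)) (by fun_prop))
    refine hK.exists_nhds_of_forall_eq (fun g hg => ?_) hN₂
    rw [SimpleGraph.dist_comm] at e3 e4
    have hg2 : G.dist (t e) g ≤ m - 2 := hg.2
    exact R.polygon.eq_of_dist_lt (t e) (t p) g (t b) (by omega) hg.1 (R.adj_right hb)
      (by omega) (by omega)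
  obtain ⟨y, hay, hsy, hty⟩ := hmerge M hM
  have d1 : G.dist (s e) (s y) = m - 1 := by
    rw [SimpleGraph.dist_comm] at e1 e2
    rw [R.polygon.dist_eq_succ c (by omega) e1 (R.adj_left ha.symm) (by omega) (R.adj_left hay) hsy]
    omega
  -- The same `g` lies over `s a` for `s` and close to `t b` for `t`.
  obtain ⟨g, hyg, heg⟩ := R.exists_proj (x := e) (y := y)
    (by rw [← c.even_dist_iff R.polygon.connected, d1])
  have hsg : s g = s a := by
    rw [SimpleGraph.dist_comm] at e1
    exact R.polygon.eq_of_dist_lt (s e) (s y) _ _ (by omega) (R.adj_left hyg)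
      (R.adj_left hay.symm) (by have := heg.1; omega) (by omega)
  obtain ⟨w₁, hw₁, hgw⟩ := R.exists_proj (x := g) (y := w)
    (by rw [hsg]; exact R.polygon.even_pred_iff c hm hw.1 (R.adj_left ha))
  obtain ⟨z, hz, hwz⟩ := R.exists_persp hw.symm hw₁
  refine hab z hz ?_ ?_
  · exact R.polygon.eq_of_opposite hm hw.1 (R.adj_left hz) (R.adj_left ha) (R.adj_left hw₁)
      hwz.symm.1 (hsg ▸ hgw.1)
  · exact k1 _ (k2 _ (k3 _ hty _ ⟨R.adj_right hyg, heg.2⟩) _ (R.adj_right hw₁) hgw.2) _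
      (R.adj_right hz) hwz.2

omit [T2Space V] in
-- Without merging, each `t v` has a neighbourhood over which `s` is constant on neighbours of `n`.
-- Finitely many of these cover the compact panel of `t n`.
theorem finite_neighborSet_of_not_merges (hgood : ∀ v, Good G H s t m v) {n : W}
    (h : ∀ v, H.Adj n v → ¬ Merges H s t n v) : (G.neighborSet (s n)).Finite := by
  have h' : ∀ v, H.Adj n v → ∃ U : Set V, IsOpen U ∧ t v ∈ U ∧
      ∀ y, H.Adj n y → t y ∈ U → s y = s v := by
    intro v hv
    have := h v hv
    unfold Merges at this
    push Not at this
    obtain ⟨N, hN, h1⟩ := this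
    obtain ⟨U, h2, h3, h4⟩ := mem_nhds_iff.1 hN
    exact ⟨U, h3, h4, fun y hy hyU => by_contra fun hne => h1 y hy hne (h2 hyU)⟩
  choose! U hU1 hU2 hU3 using h'
  have hK : IsCompact (G.neighborSet (t n)) :=
    (R.isClosed_adj.preimage (f := fun q : V => (t n, q)) (by fun_prop)).isCompact
  obtain ⟨F, hF⟩ := hK.elim_finite_subcover (fun v : H.neighborSet n => U v)
    (fun v => hU1 v v.2) (by
      intro y hy
      obtain ⟨v, hv, rfl⟩ := R.symm.exists_lift (hgood n).symm hy
      exact Set.mem_iUnion.2 ⟨⟨v, hv⟩, hU2 v hv⟩)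
  refine (F.finite_toSet.image fun v : H.neighborSet n => s v).subset ?_
  intro x hx
  obtain ⟨y, hy, rfl⟩ := R.exists_lift (hgood n) hx
  obtain ⟨v, hv⟩ := Set.mem_iUnion.1 (hF (R.adj_right hy))
  obtain ⟨hvF, hyv⟩ := Set.mem_iUnion.1 hv
  exact ⟨v, hvF, (hU3 v v.2 y hy hyv).symm⟩

/-- A splitting forces finite panels, all of which contain splittings. -/
theorem splits_and_finite (hgood : ∀ v, Good G H s t m v) {p a b : W} (ha : H.Adj p a)
    (hb : H.Adj p b) {N : Set V} (hN : N ∈ 𝓝 (t b)) (hab : ∀ z, H.Adj p z → s z = s a → t z ∉ N)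
    {n v : W} (hnv : H.Adj n v) (hsplit : Splits H s t n v) (hc : c (s v) = c (s p)) {n' : W}
    (hn' : c (s n') ≠ c (s p)) :
    (G.neighborSet (s n')).Finite ∧ ∀ v', H.Adj n' v' → Splits H s t n' v' := by
  refine ⟨R.finite_neighborSet_of_not_merges hgood fun v' hv' hmerge => ?_, fun v' hv' => ?_⟩
  · refine R.not_merges_of_splits hgood ha hb hN hab ?_ ?_
    · exact R.transport_all hgood R.transports_splits hnv hsplit hb.symm hc.symm
    · refine R.transport_all hgood R.transports_merges hv' hmerge ha.symm ?_
      have := c.valid (R.adj_left hv')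
      omega
  · refine R.transport_all hgood R.transports_splits hnv hsplit hv' ?_
    have := c.valid (R.adj_left hv')
    omega

/-- A vertex `v` at which the images under `s` and `t` are bounded in terms of each other. -/
structure IsTame (G : SimpleGraph V) (H : SimpleGraph W) (s t : W → V) (v : W) : Prop where
  bounded_left : ∃ a b, H.Adj v a ∧ H.Adj v b ∧
    ∃ N ∈ 𝓝 (t b), ∀ z, H.Adj v z → s z = s a → t z ∉ N
  bounded_right : ∃ a b, H.Adj v a ∧ H.Adj v b ∧
    ∃ N ∈ 𝓝 (s b), ∀ z, H.Adj v z → t z = t a → s z ∉ N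
  not_splits : (G.neighborSet (s v)).Finite ∨ (G.neighborSet (t v)).Finite →
    ∀ o, H.Adj v o → ¬ Splits H s t v o ∧ ¬ Splits H t s v o

omit R [CompactSpace V] [T2Space V] in
theorem IsTame.symm {v : W} (h : IsTame G H s t v) : IsTame G H t s v :=
  ⟨h.bounded_right, h.bounded_left, fun h1 o ho => (h.not_splits h1.symm o ho).symm⟩

/-- If `v` has the colour of `p`, a splitting makes the panel of `q` finite and splits it at `p`,
against tameness of `q`; otherwise `p` and `q` exchange roles. -/
theorem not_splits (hgood : ∀ v, Good G H s t m v) {p q : W} (hpq : H.Adj p q)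
    (hp : IsTame G H s t p) (hq : IsTame G H s t q) {n v : W} (hnv : H.Adj n v) :
    ¬ Splits H s t n v := by
  have key : ∀ {p q}, H.Adj p q → IsTame G H s t p → IsTame G H s t q →
      c (s v) = c (s p) → ¬ Splits H s t n v := by
    intro p q hpq hp hq hc hs
    obtain ⟨a, b, ha, hb, N, hN, h⟩ := hp.bounded_left
    obtain ⟨h1, h2⟩ := R.splits_and_finite hgood ha hb hN h hnv hs hc
      (c.valid (R.adj_left hpq)).symm
    exact (hq.not_splits (Or.inl h1) p hpq.symm).1 (h2 p hpq.symm)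
  have := c.valid (R.adj_left hpq)
  by_cases hc : c (s v) = c (s p)
  · exact key hpq hp hq hc
  · exact key hpq.symm hq hp (by omega)

omit [CompactSpace V] [T2Space V] in
/-- If `s` and `t` identify the same pairs of vertices with a common neighbour, then they identify
the same pairs of vertices. -/
theorem eq_iff_eq (hgood : ∀ v, Good G H s t m v)
    (h : ∀ n x y, H.Adj n x → H.Adj n y → (s x = s y ↔ t x = t y)) (x y : W) :
    s x = s y ↔ t x = t y := by
  have hm := R.three_le
  have lift : ∀ {a b a'}, s a = s b → t a = t b → H.Adj a a' →
      ∃ b', H.Adj b b' ∧ s b' = s a' ∧ t b' = t a' := by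
    intro a b a' h1 h2 ha'
    obtain ⟨w, hw⟩ := (hgood a).2
    have hw' : BiDist G s t b w m := by rw [BiDist, ← h1, ← h2]; exact hw
    obtain ⟨e, he, hae⟩ := R.exists_persp hw ha'
    obtain ⟨b', hb', heb⟩ := R.exists_persp hw'.symm he
    have hb1 := R.adj_left hb'
    have hb2 := R.adj_right hb'
    rw [← h1] at hb1
    rw [← h2] at hb2
    exact ⟨b', hb', R.polygon.eq_of_opposite hm hw.1 hb1 (R.adj_left ha') (R.adj_left he)
      heb.symm.1 hae.1, R.polygon.eq_of_opposite hm hw.2 hb2 (R.adj_right ha') (R.adj_right he)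
      heb.symm.2 hae.2⟩
  -- Each vertex is replaced by a representative with the same two images, reached from `x` by a
  -- walk that is geodesic in both.
  have step : ∀ {y z}, H.Adj y z →
      (∃ y', s y' = s y ∧ t y' = t y ∧ ∃ w : H.Walk x y', BiDist G s t x y' w.length) →
      ∃ z', s z' = s z ∧ t z' = t z ∧ ∃ w : H.Walk x z', BiDist G s t x z' w.length := by
    rintro y z hyz ⟨y', h1, h2, w, hw⟩
    obtain ⟨z', hz', h3, h4⟩ := lift h1.symm h2.symm hyz
    rcases Nat.eq_zero_or_pos w.length with h0 | hpos
    · cases w with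
      | nil => exact ⟨z', h3, h4, SimpleGraph.Walk.cons hz' SimpleGraph.Walk.nil,
          by simpa using R.biDist_one hz'⟩
      | cons _ _ => simp at h0
    · obtain ⟨f, hf, w', hw'⟩ := SimpleGraph.exists_walk_concat (k := w.length - 1) w (by omega)
      have hxf := R.biLe_of_walk w'
      rw [hw'] at hxf
      have hd1 := R.polygon.dist_le_succ (s x) (R.adj_left hf.symm)
      have hd2 := R.polygon.dist_le_succ (t x) (R.adj_right hf.symm)
      rw [hw.1] at hd1
      rw [hw.2] at hd2
      have hxf1 := hxf.1
      have hxf2 := hxf.2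
      by_cases he : s z' = s f
      · have he' := (h y' z' f hz' hf).1 he
        exact ⟨f, he ▸ h3, he' ▸ h4, w', by omega, by omega⟩
      · have he' : t z' ≠ t f := fun e => he ((h y' z' f hz' hf).2 e)
        have hle := R.polygon.dist_le (s x) (s y')
        rw [hw.1] at hle
        rcases hle.lt_or_eq with hlt | heq
        · have := R.biDist_succ hlt hw hf hxf hpos hz' ⟨he, he'⟩
          exact ⟨z', h3, h4, w.concat hz', by simpa using this⟩
        -- At the diameter both distances must drop to `m - 1`, and a new walk of that length is
        -- taken.
        · have hl1 := c.dist_adj R.polygon.connected (s x) (R.adj_left hz')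
          have hl2 := c.dist_adj R.polygon.connected (t x) (R.adj_right hz')
          have hl3 := R.polygon.dist_le (s x) (s z')
          have hl4 := R.polygon.dist_le (t x) (t z')
          rw [hw.1] at hl1
          rw [hw.2] at hl2
          have hd3 : G.dist (s x) (s z') = m - 1 := by omega
          have hd4 : G.dist (t x) (t z') = m - 1 := by omega
          obtain ⟨w'', hw''⟩ := R.exists_walk (m - 1) x z' le_rfl
            (by rw [← c.even_dist_iff R.polygon.connected, hd3])
          exact ⟨z', h3, h4, w'', by rw [hw'']; exact ⟨hd3, hd4⟩⟩
  have walk : ∀ {a b} (_ : H.Walk a b),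
      (∃ y', s y' = s a ∧ t y' = t a ∧ ∃ w : H.Walk x y', BiDist G s t x y' w.length) →
      ∃ z', s z' = s b ∧ t z' = t b ∧ ∃ w : H.Walk x z', BiDist G s t x z' w.length := by
    intro a b w
    induction w with
    | nil => exact id
    | cons hadj w ih => exact fun hQ => ih (step hadj hQ)
  obtain ⟨w⟩ := R.exists_walk_to x y
  obtain ⟨z, h1, h2, w', hw'⟩ := walk w ⟨x, rfl, rfl, SimpleGraph.Walk.nil, by simp [BiDist]⟩
  rw [← h1, ← h2, ← R.polygon.connected.dist_eq_zero_iff, ← R.polygon.connected.dist_eq_zero_iff,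
    hw'.1, hw'.2]

theorem eq_iff_eq_of_isTame (hgood : ∀ v, Good G H s t m v) {p q : W} (hpq : H.Adj p q)
    (hp : IsTame G H s t p) (hq : IsTame G H s t q) (x y : W) : s x = s y ↔ t x = t y := by
  refine R.eq_iff_eq hgood (fun n x y hx hy => ⟨fun h => ?_, fun h => ?_⟩) x y
  · by_contra hne
    exact R.not_splits hgood hpq hp hq hy ⟨x, hx, h, hne⟩
  · by_contra hne
    exact R.symm.not_splits (fun v => (hgood v).symm) hpq hp.symm hq.symm hy ⟨x, hx, h, hne⟩

end ResiduePair

/-! ### Ultrapowers and limits -/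

open Filter

namespace SimpleGraph

variable {V ι : Type*} {G : SimpleGraph V} {m : ℕ}

theorem exists_walk_length_add_two_mul (hnb : ∀ v, ∃ w, G.Adj v w) {x y : V} (p : G.Walk x y)
    (j : ℕ) : ∃ w : G.Walk x y, w.length = p.length + 2 * j := by
  induction j with
  | zero => exact ⟨p, rfl⟩
  | succ j ih =>
    obtain ⟨w, hw⟩ := ih
    obtain ⟨z, hz⟩ := hnb x
    exact ⟨Walk.cons hz (Walk.cons hz.symm w), by simp [hw]; ring⟩

/-- Parity excludes distance `k + 1`; a geodesic is then padded by backtracking. -/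
theorem IsGeneralizedPolygon.exists_walk_length_eq (hG : G.IsGeneralizedPolygon m)
    (c : G.Coloring (Fin 2)) (hnb : ∀ v, ∃ w, G.Adj v w) {k : ℕ} (hk : m - 1 ≤ k) {x y : V}
    (h : Even k ↔ c x = c y) : ∃ w : G.Walk x y, w.length = k := by
  obtain ⟨p, hp⟩ := hG.connected.exists_walk_length_eq_dist x y
  rw [← c.even_dist_iff hG.connected] at h
  have h1 := hG.dist_le x y
  have h2 : G.dist x y ≤ k := by
    by_contra hc
    have e : G.dist x y = k + 1 := by omega
    rw [e, Nat.even_add_one] at h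
    tauto
  have h3 : Even (k - G.dist x y) := by rw [Nat.even_sub h2]; exact h
  obtain ⟨j, hj⟩ := h3
  obtain ⟨w, hw⟩ := exists_walk_length_add_two_mul hnb p j
  exact ⟨w, by omega⟩

/-- Two families of vertices are adjacent if their members are adjacent along the ultrafilter. -/
def ultrapower (G : SimpleGraph V) (U : Ultrafilter ι) : SimpleGraph (ι → V) where
  Adj a b := ∀ᶠ i in U, G.Adj (a i) (b i)
  symm := ⟨fun _ _ h => h.mono fun _ h => h.symm⟩
  loopless := ⟨fun _ h => by
    obtain ⟨i, hi⟩ := h.exists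
    exact G.loopless.irrefl _ hi⟩

/-- Length `0` is excluded: families equal only along `U` are different vertices. -/
theorem exists_walk_ultrapower {U : Ultrafilter ι} (k : ℕ) (hk : 1 ≤ k) (a b : ι → V)
    (h : ∀ᶠ i in U, ∃ w : G.Walk (a i) (b i), w.length = k) :
    ∃ w : (G.ultrapower U).Walk a b, w.length = k := by
  induction k, hk using Nat.le_induction generalizing a with
  | base =>
    have hab : (G.ultrapower U).Adj a b :=
      h.mono fun i ⟨w, hw⟩ => Walk.adj_of_length_eq_one hw
    exact ⟨hab.toWalk, rfl⟩
  | succ k hk ih =>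
    have : ∀ i, ∃ z, (∃ w : G.Walk (a i) (b i), w.length = k + 1) →
        G.Adj (a i) z ∧ ∃ w : G.Walk z (b i), w.length = k := by
      intro i
      by_cases hi : ∃ w : G.Walk (a i) (b i), w.length = k + 1
      · obtain ⟨w, hw⟩ := hi
        obtain ⟨z, hz, w', hw'⟩ := exists_walk_concat w.reverse (by simpa using hw)
        exact ⟨z, fun _ => ⟨hz, w'.reverse, by simpa using hw'⟩⟩
      · exact ⟨a i, fun h => absurd h hi⟩
    choose z hz using this
    obtain ⟨w, hw⟩ := ih z (h.mono fun i hi => (hz i hi).2)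
    have haz : (G.ultrapower U).Adj a z := h.mono fun i hi => (hz i hi).1
    exact ⟨Walk.cons haz w, by rw [Walk.length_cons, hw]⟩

end SimpleGraph

namespace Ultrafilter

variable {X ι : Type*} [TopologicalSpace X] [CompactSpace X]

/-- The limit of a family of points of a compact space along an ultrafilter. -/
noncomputable def limit (U : Ultrafilter ι) (a : ι → X) : X := (U.map a).lim

theorem tendsto_limit (U : Ultrafilter ι) (a : ι → X) : Tendsto a U (𝓝 (U.limit a)) :=
  (U.map a).le_nhds_lim

theorem limit_eq [T2Space X] {U : Ultrafilter ι} {a : ι → X} {x : X} (h : Tendsto a U (𝓝 x)) :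
    U.limit a = x :=
  tendsto_nhds_unique (U.tendsto_limit a) h

theorem limit_const [T2Space X] (U : Ultrafilter ι) (x : X) : U.limit (fun _ => x) = x :=
  limit_eq tendsto_const_nhds

theorem limit_congr [T2Space X] {U : Ultrafilter ι} {a b : ι → X} (h : ∀ᶠ i in U, a i = b i) :
    U.limit a = U.limit b :=
  limit_eq ((U.tendsto_limit b).congr' (h.mono fun _ h => h.symm))

theorem limit_mem {U : Ultrafilter ι} {a : ι → X} {K : Set X} (hK : IsClosed K)
    (h : ∀ᶠ i in U, a i ∈ K) : U.limit a ∈ K :=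
  hK.mem_of_tendsto (U.tendsto_limit a) h

theorem limit_prod_mem {U : Ultrafilter ι} {a b : ι → X} {K : Set (X × X)} (hK : IsClosed K)
    (h : ∀ᶠ i in U, (a i, b i) ∈ K) : (U.limit a, U.limit b) ∈ K :=
  hK.mem_of_tendsto ((U.tendsto_limit a).prodMk_nhds (U.tendsto_limit b)) h

end Ultrafilter

section Residues

variable {V ι : Type*} [TopologicalSpace V] [CompactSpace V] [T2Space V] {G : SimpleGraph V}
  {c : G.Coloring (Fin 2)} {m : ℕ}

/-- The limits of the family moved by automorphisms. -/
noncomputable def SimpleGraph.movedLimit (φ : ι → G ≃g G) (U : Ultrafilter ι) (a : ι → V) : V :=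
  U.limit fun i => φ i (a i)

/-- Colours pass to limits because colour classes are open. The moved limit is onto since the family
of preimages of `x` is moved to the constant `x`. -/
theorem SimpleGraph.IsGeneralizedPolygon.residuePair (hG : G.IsGeneralizedPolygon m) (hm : 3 ≤ m)
    (hnb : ∀ v, ∃ w, G.Adj v w) (hcl : IsClosed {p : V × V | G.Adj p.1 p.2}) (hc : Continuous c)
    (φ : ι → G ≃g G) (U : Ultrafilter ι) (hφ : ∀ᶠ i in U, ∀ x, c (φ i x) = c x) :
    ResiduePair G c m (G.ultrapower U) U.limit (G.movedLimit φ U) := by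
  have hcol : ∀ a : ι → V, ∀ᶠ i in U, c (a i) = c (U.limit a) := fun a =>
    (hc.tendsto _).comp (U.tendsto_limit a) |>.eventually_mem
      ((isOpen_discrete {c (U.limit a)}).mem_nhds rfl)
  refine ⟨hG, hm, hcl, fun h => Ultrafilter.limit_prod_mem hcl h,
    fun {a b} h => Ultrafilter.limit_prod_mem hcl
      (h.mono fun i hi => (φ i).map_adj_iff.2 hi), fun a => ?_, fun x => ⟨_, U.limit_const x⟩,
      fun x => ⟨fun i => (φ i).symm x, ?_⟩, fun k a b hk h => ?_⟩
  · obtain ⟨i, h1, h2, h3⟩ := ((hcol a).and ((hcol fun i => φ i (a i)).and hφ)).exists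
    rw [← h1, ← h3, h2]; rfl
  · simp only [SimpleGraph.movedLimit, RelIso.apply_symm_apply]
    exact U.limit_const x
  · refine SimpleGraph.exists_walk_ultrapower k (by omega) a b ?_
    filter_upwards [hcol a, hcol b] with i h1 h2
    exact hG.exists_walk_length_eq c hnb hk (by rw [h1, h2]; exact h)

end Residues

/-! ### Small displacement at the chamber `C` -/

section Base

variable {V ι : Type*} [MetricSpace V] [CompactSpace V] {G : SimpleGraph V}
  {c : G.Coloring (Fin 2)} {m : ℕ}

/-- `δ` is small with respect to the distances of some neighbours of `p`, and points `δ`-close to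
`p` and `u` are opposite. -/
structure IsMargin (G : SimpleGraph V) (m : ℕ) (p u : V) (δ : ℝ) : Prop where
  pos : 0 < δ
  separated : ∃ q : Fin 3 → V, (∀ j, G.Adj p (q j)) ∧ ∀ j k, j ≠ k → 4 * δ < dist (q j) (q k)
  opposite : ∀ x y, dist p x ≤ δ → dist u y ≤ δ → G.dist x y = m

omit [CompactSpace V] in
theorem IsMargin.mono {p u : V} {δ δ' : ℝ} (h : IsMargin G m p u δ) (h0 : 0 < δ')
    (hle : δ' ≤ δ) : IsMargin G m p u δ' where
  pos := h0
  separated := by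
    obtain ⟨q, h1, h2⟩ := h.separated
    exact ⟨q, h1, fun j k hjk => by have := h2 j k hjk; linarith⟩
  opposite x y h1 h2 := h.opposite x y (h1.trans hle) (h2.trans hle)

theorem exists_isMargin (hG : G.IsGeneralizedPolygon m)
    (hm : 3 ≤ m) (hcl : IsClosed {p : V × V | G.Adj p.1 p.2})
    (hthick : ∀ v, 3 ≤ (G.neighborSet v).encard) {p u : V} (hpu : G.dist p u = m) :
    ∃ δ, IsMargin G m p u δ := by
  obtain ⟨F, hF, hF3⟩ := Set.exists_subset_encard_eq (hthick p)
  obtain ⟨a, b, d, hab, had, hbd, rfl⟩ := Set.encard_eq_three.1 hF3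
  have hK := (hG.connected.isClosed_setOf_dist_le hcl (m - 1)).isOpen_compl
  obtain ⟨r, hr, hball⟩ := Metric.isOpen_iff.1 hK (p, u) (by
    simp only [Set.mem_compl_iff, Set.mem_ofPred_eq]; omega)
  have h1 := dist_pos.2 hab
  have h2 := dist_pos.2 had
  have h3 := dist_pos.2 hbd
  -- Dividing by `5` makes `4 * δ` strictly less than each mutual distance; `r / 2` puts closed
  -- balls inside the open one.
  refine ⟨min (r / 2) (min (dist a b) (min (dist a d) (dist b d)) / 5), by positivity,
    ⟨![a, b, d], fun j => ?_, fun j k hjk => ?_⟩, fun x y hx hy => ?_⟩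
  · fin_cases j <;> exact hF (by simp)
  · have e0 := min_le_right (r / 2) (min (dist a b) (min (dist a d) (dist b d)) / 5)
    have e1 := min_le_left (dist a b) (min (dist a d) (dist b d))
    have e2 := (min_le_right (dist a b) (min (dist a d) (dist b d))).trans (min_le_left _ _)
    have e3 := (min_le_right (dist a b) (min (dist a d) (dist b d))).trans (min_le_right _ _)
    have c1 := dist_comm a b
    have c2 := dist_comm a d
    have c3 := dist_comm b d
    fin_cases j <;> fin_cases k <;> first | exact absurd rfl hjk | (simp; linarith)
  · have e0 := min_le_left (r / 2) (min (dist a b) (min (dist a d) (dist b d)) / 5)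
    have h4 : (x, y) ∈ Metric.ball (p, u) r := by
      rw [Metric.mem_ball, dist_comm, Prod.dist_eq, max_lt_iff]
      exact ⟨by simp only; linarith, by simp only; linarith⟩
    have h5 := hball h4
    simp only [Set.mem_compl_iff, Set.mem_ofPred_eq] at h5
    have := hG.dist_le x y
    omega

variable {φ : ι → G ≃g G} {U : Ultrafilter ι}

theorem dist_limit_movedLimit_le {δ : ℝ} {a : ι → V}
    (h : ∀ᶠ i in U, dist (a i) (φ i (a i)) ≤ δ) : dist (U.limit a) (G.movedLimit φ U a) ≤ δ :=
  le_of_tendsto ((U.tendsto_limit a).dist (U.tendsto_limit _)) h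

variable (R : ResiduePair G c m (G.ultrapower U) U.limit (G.movedLimit φ U))

include R

/-- Each neighbour of `p` has its two images within `δ`. So each of `o`, `o'` fails to be separated
from at most one of the three `q j`, and one `q j` remains. In the finite case, counting makes `t` a
bijection from the panel of `p` to that of `t p`. -/
theorem ResiduePair.good_and_isTame_of_isMargin {p u : V} {δ : ℝ} (hδ : IsMargin G m p u δ)
    (hp : ∀ᶠ i in U, dist p (φ i p) ≤ δ) (hu : ∀ᶠ i in U, dist u (φ i u) ≤ δ)
    (ho : ∀ᶠ i in U, ∀ o, G.Adj p o → dist o (φ i o) ≤ δ) :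
    ResiduePair.Good G (G.ultrapower U) U.limit (G.movedLimit φ U) m (fun _ => p) ∧
    ResiduePair.IsTame G (G.ultrapower U) U.limit (G.movedLimit φ U) (fun _ => p) := by
  obtain ⟨q, hq, hqd⟩ := hδ.separated
  have hδ0 := hδ.pos
  set t := G.movedLimit φ U with ht
  have hd : ∀ a : ι → V, (G.ultrapower U).Adj (fun _ => p) a → dist (U.limit a) (t a) ≤ δ :=
    fun a ha => dist_limit_movedLimit_le
      ((Filter.Eventually.and ha ho).mono fun i hi => hi.2 _ hi.1)
  have hqa : ∀ j, (G.ultrapower U).Adj (fun _ => p) (fun _ => q j) := fun j =>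
    Filter.Eventually.of_forall fun _ => hq j
  have hqd' : ∀ j, dist (q j) (t fun _ => q j) ≤ δ := fun j => by
    have := hd _ (hqa j)
    rwa [U.limit_const] at this
  have hpt : dist p (t fun _ => p) ≤ δ := by
    have := dist_limit_movedLimit_le (G := G) (φ := φ) (a := fun _ => p) hp
    rwa [U.limit_const] at this
  have hut : dist u (t fun _ => u) ≤ δ := by
    have := dist_limit_movedLimit_le (G := G) (φ := φ) (a := fun _ => u) hu
    rwa [U.limit_const] at this
  have close : ∀ a : ι → V, (G.ultrapower U).Adj (fun _ => p) a → ∀ j,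
      ¬(U.limit (fun _ => q j) ≠ U.limit a ∧ t (fun _ => q j) ≠ t a) →
        dist (q j) (U.limit a) ≤ 2 * δ := by
    intro a ha j hj
    rw [U.limit_const, not_and_or, not_not, not_not] at hj
    rcases hj with e | e
    · rw [e, dist_self]; linarith
    · have h1 := hd a ha
      have h2 := hqd' j
      rw [e] at h2
      rw [dist_comm] at h1
      linarith [dist_triangle (q j) (t a) (U.limit a)]
  have far : ∀ a : ι → V, (G.ultrapower U).Adj (fun _ => p) a → ∀ j k, j ≠ k →
      dist (q j) (U.limit a) ≤ 2 * δ → ¬ dist (q k) (U.limit a) ≤ 2 * δ := by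
    intro a ha j k hjk h1 h2
    rw [dist_comm (q k)] at h2
    linarith [hqd j k hjk, dist_triangle (q j) (U.limit a) (q k)]
  have hgood : ResiduePair.Good G (G.ultrapower U) U.limit t m (fun _ => p) := by
    refine ⟨fun o o' ho ho' => ?_, fun _ => u, ?_, ?_⟩
    · by_contra hcon
      push Not at hcon
      have hor : ∀ j, dist (q j) (U.limit o) ≤ 2 * δ ∨ dist (q j) (U.limit o') ≤ 2 * δ := by
        intro j
        by_contra hj
        rw [not_or] at hj
        have h1 : U.limit (fun _ => q j) ≠ U.limit o ∧ t (fun _ => q j) ≠ t o := by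
          by_contra hh; exact hj.1 (close o ho j hh)
        have h2 : U.limit (fun _ => q j) ≠ U.limit o' ∧ t (fun _ => q j) ≠ t o' := by
          by_contra hh; exact hj.2 (close o' ho' j hh)
        exact h2.2 (hcon _ (hqa j) h1 h2.1)
      have f := far o ho
      have f' := far o' ho'
      have g0 := hor 0
      have g1 := hor 1
      have g2 := hor 2
      have a1 := f 0 1 (by decide)
      have a2 := f 0 2 (by decide)
      have a3 := f 1 2 (by decide)
      have b1 := f' 0 1 (by decide)
      have b2 := f' 0 2 (by decide)
      have b3 := f' 1 2 (by decide)
      tauto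
    · rw [U.limit_const, U.limit_const]
      exact hδ.opposite p u (by simpa using hδ0.le) (by simpa using hδ0.le)
    · exact hδ.opposite _ _ hpt hut
  refine ⟨hgood, ?_, ?_, ?_⟩
  · refine ⟨fun _ => q 0, fun _ => q 1, hqa 0, hqa 1, Metric.ball (t fun _ => q 1) δ,
      Metric.ball_mem_nhds _ hδ0, fun z hz e hN => ?_⟩
    rw [Metric.mem_ball] at hN
    rw [U.limit_const] at e
    have h1 := hd z hz
    have h2 := hqd' 1
    rw [e] at h1
    rw [dist_comm] at h2
    linarith [hqd 0 1 (by decide), dist_triangle4 (q 0) (t z) (t fun _ => q 1) (q 1)]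
  · refine ⟨fun _ => q 0, fun _ => q 1, hqa 0, hqa 1, Metric.ball (U.limit fun _ => q 1) δ,
      Metric.ball_mem_nhds _ hδ0, fun z hz e hN => ?_⟩
    rw [Metric.mem_ball, U.limit_const] at hN
    have h1 := hd z hz
    have h2 := hqd' 0
    rw [← e] at h2
    rw [dist_comm] at h1
    linarith [hqd 0 1 (by decide), dist_triangle4 (q 0) (t z) (U.limit z) (q 1)]
  -- Both `p` and its moved limit are opposite to `u`, so their panels have equal cardinality.
  · rw [U.limit_const]
    intro hfin o ho1
    have hcard := (R.polygon.encard_neighborSet_eq c R.three_le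
        (hδ.opposite p u (by simpa using hδ0.le) (by simpa using hδ0.le))).trans
      (R.polygon.encard_neighborSet_eq c R.three_le
        (hδ.opposite (t fun _ => p) u hpt (by simpa using hδ0.le))).symm
    have hfin1 : (G.neighborSet p).Finite := by
      rcases hfin with h | h
      · exact h
      · rw [← Set.encard_lt_top_iff] at h ⊢; rwa [hcard]
    have hfin2 : (G.neighborSet (t fun _ => p)).Finite := by
      rw [← Set.encard_lt_top_iff] at hfin1 ⊢; rwa [← hcard]
    have hconst : ∀ x : ι → V, (G.ultrapower U).Adj (fun _ => p) x →
        ∃ x₀, G.Adj p x₀ ∧ ∀ᶠ i in U, x i = x₀ := by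
      intro x hx
      -- A family with values in a finite set is constant along an ultrafilter.
      have : (⋃ x₀ ∈ G.neighborSet p, {i | x i = x₀}) ∈ U :=
        Filter.mem_of_superset hx fun i hi => Set.mem_biUnion (x := x i) hi rfl
      exact (Ultrafilter.finite_biUnion_mem_iff hfin1).1 this
    have tcongr : ∀ {x y : ι → V}, (∀ᶠ i in U, x i = y i) → t x = t y := fun h =>
      Ultrafilter.limit_congr (h.mono fun i hi => by rw [hi])
    have himage : (fun v => t fun _ => v) '' G.neighborSet p = G.neighborSet (t fun _ => p) := by
      refine Set.Subset.antisymm ?_ fun y hy => ?_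
      · rintro _ ⟨x, hx, rfl⟩
        exact R.adj_right (x := fun _ => p) (y := fun _ => x) (Filter.Eventually.of_forall fun _ => hx)
      · obtain ⟨z, hz, rfl⟩ := R.symm.exists_lift hgood.symm hy
        obtain ⟨x₀, h1, h2⟩ := hconst z hz
        exact ⟨x₀, h1, (tcongr h2).symm⟩
    have hinj : Set.InjOn (fun v => t fun _ => v) (G.neighborSet p) :=
      hfin1.injOn_of_encard_image_eq (by rw [himage, hcard])
    obtain ⟨o₀, ho₀, ho₁⟩ := hconst o ho1
    refine ⟨?_, ?_⟩
    · rintro ⟨x, hx, h1, h2⟩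
      obtain ⟨x₀, hx₀, hx₁⟩ := hconst x hx
      rw [Ultrafilter.limit_congr hx₁, Ultrafilter.limit_congr ho₁, U.limit_const,
        U.limit_const] at h1
      subst h1
      exact h2 (tcongr (hx₁.mp (ho₁.mono fun i hi hi' => hi'.trans hi.symm)))
    · rintro ⟨x, hx, h1, h2⟩
      obtain ⟨x₀, hx₀, hx₁⟩ := hconst x hx
      rw [tcongr hx₁, tcongr ho₁] at h1
      have := hinj hx₀ ho₀ h1
      subst this
      exact h2 (Ultrafilter.limit_congr (hx₁.mp (ho₁.mono fun i hi hi' => hi'.trans hi.symm)))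

end Base

/-! ### The limit automorphism -/

section LimitAutomorphism

variable {V ι : Type*} [MetricSpace V] [CompactSpace V] {G : SimpleGraph V}
  {c : G.Coloring (Fin 2)} {m : ℕ} {φ : ι → G ≃g G} {U : Ultrafilter ι}

/-- If `f` were discontinuous at `x`, let `a i` be the point nearest to `x` among those that `φ i`
sends at distance at least `r` from `f x`. Then `a` tends to `x` while its moved limit stays away
from `f x`. -/
theorem continuous_of_movedLimit_eq (hφ : ∀ i, Continuous (φ i)) {f : V → V}
    (hf : ∀ a, G.movedLimit φ U a = f (U.limit a)) : Continuous f := by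
  have hf' : ∀ a, Tendsto (fun i => φ i (a i)) U (𝓝 (f (U.limit a))) := fun a => by
    rw [← hf]; exact U.tendsto_limit _
  refine continuous_iff_continuousAt.2 fun x => ?_
  by_contra hcon
  rw [ContinuousAt, (Metric.nhds_basis_ball).tendsto_iff Metric.nhds_basis_closedBall] at hcon
  push Not at hcon
  obtain ⟨r, hr, hbad⟩ := hcon
  let E : ι → Set V := fun i => {v | r ≤ dist (φ i v) (f x)}
  have hE : ∀ i, IsClosed (E i) := fun i =>
    isClosed_le continuous_const ((hφ i).dist continuous_const)
  have hnear : ∀ d > 0, ∀ᶠ i in U, ∃ v ∈ E i, dist x v < d := by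
    intro d hd
    obtain ⟨v, hv, hfv⟩ := hbad d hd
    have h1 := hf' fun _ => v
    rw [U.limit_const] at h1
    rw [Metric.mem_closedBall, not_le] at hfv
    filter_upwards [(h1.dist tendsto_const_nhds).eventually (lt_mem_nhds hfv)] with i hi
    exact ⟨v, hi.le, by rw [dist_comm]; exact hv⟩
  have : ∀ i, ∃ v, (E i).Nonempty → v ∈ E i ∧ Metric.infDist x (E i) = dist x v := by
    intro i
    by_cases hne : (E i).Nonempty
    · obtain ⟨v, hv⟩ := (hE i).isCompact.exists_infDist_eq_dist hne x
      exact ⟨v, fun _ => hv⟩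
    · exact ⟨x, fun h => absurd h hne⟩
  choose a ha using this
  have hax : Tendsto a U (𝓝 x) := by
    rw [Metric.tendsto_nhds]
    intro d hd
    filter_upwards [hnear d hd] with i ⟨v, hv, hd⟩
    rw [dist_comm, ← (ha i ⟨v, hv⟩).2]
    exact (Metric.infDist_le_dist_of_mem hv).trans_lt hd
  have h1 := hf' a
  rw [Ultrafilter.limit_eq hax] at h1
  obtain ⟨i, h2, v, h3, -⟩ := ((Metric.tendsto_nhds.1 h1 r hr).and (hnear 1 one_pos)).exists
  exact absurd h2 (not_lt.2 (ha i ⟨v, h3⟩).1)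

/-- If moving by automorphisms respects equality of limits, the automorphisms converge to an
automorphism. -/
theorem ResiduePair.exists_limit_iso
    (R : ResiduePair G c m (G.ultrapower U) U.limit (G.movedLimit φ U))
    (hφ : ∀ i, Continuous (φ i))
    (h : ∀ a b, U.limit a = U.limit b ↔ G.movedLimit φ U a = G.movedLimit φ U b) :
    ∃ f : G ≃g G, IsHomeomorph f ∧ (∀ x, c (f x) = c x) ∧
      ∀ a, G.movedLimit φ U a = f (U.limit a) := by
  let f : V → V := fun x => G.movedLimit φ U fun _ => x
  have hf : ∀ a, G.movedLimit φ U a = f (U.limit a) := fun a =>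
    (h _ _).1 (U.limit_const _).symm
  have hinj : Function.Injective f := fun x y e => by
    have := (h _ _).2 e
    rwa [U.limit_const, U.limit_const] at this
  have hsurj : Function.Surjective f := fun y => by
    obtain ⟨a, rfl⟩ := R.surjective_right y
    exact ⟨_, (hf a).symm⟩
  have hcont := continuous_of_movedLimit_eq hφ hf
  refine ⟨⟨Equiv.ofBijective f ⟨hinj, hsurj⟩, fun {x y} => ⟨fun hadj => ?_, fun hadj => ?_⟩⟩,
    isHomeomorph_iff_continuous_bijective.2 ⟨hcont, hinj, hsurj⟩, fun x => ?_, hf⟩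
  -- Adjacency is pulled back through the families of preimages, whose limits are determined by
  -- injectivity of `f`.
  · have key : ∀ x, U.limit (fun i => (φ i).symm (f x)) = x := fun x => by
      apply hinj
      rw [← hf]
      simp only [SimpleGraph.movedLimit, RelIso.apply_symm_apply]
      exact U.limit_const _
    rw [← key x, ← key y]
    exact R.adj_left (x := fun i => (φ i).symm (f x)) (y := fun i => (φ i).symm (f y))
      (Eventually.of_forall fun i => (φ i).symm.map_adj_iff.2 hadj)
  · exact R.adj_right (x := fun _ => x) (y := fun _ => y) (Eventually.of_forall fun _ => hadj)
  · have := R.color_eq fun _ => x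
    rw [U.limit_const] at this
    exact this.symm

end LimitAutomorphism

theorem MetricSpace.exists_pos_forall_dist_le {X Y : Type*} {τ : TopologicalSpace X}
    [CompactSpace X] (ρ : MetricSpace X) (hρ : ρ.toUniformSpace.toTopologicalSpace = τ)
    [PseudoMetricSpace Y] {g : X → Y} (hg : Continuous g) {δ : ℝ} (hδ : 0 < δ) :
    ∃ ε > 0, ∀ x y, ρ.dist x y ≤ ε → dist (g x) (g y) ≤ δ := by
  subst hρ
  obtain ⟨ε, hε, h⟩ := Metric.uniformContinuous_iff.1
    (CompactSpace.uniformContinuous_of_continuous hg) δ hδ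
  refine ⟨ε / 2, half_pos hε, fun x y hxy => (h ?_).le⟩
  exact lt_of_le_of_lt hxy (half_lt_self hε)

theorem MetricSpace.isClosed_setOf_dist_le {X : Type*} {τ : TopologicalSpace X}
    (ρ : MetricSpace X) (hρ : ρ.toUniformSpace.toTopologicalSpace = τ) (x : X) (ε : ℝ) :
    IsClosed {y | ρ.dist x y ≤ ε} := by
  subst hρ
  exact isClosed_le (continuous_const.dist continuous_id) continuous_const

/-! ### Chambers, types and the compact-open topology -/

namespace RankTwoBuilding

variable {V : Type*} {m : ℕ} (Δ : RankTwoBuilding V m)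

/-- The edges of a walk form a gallery; attaching prescribed chambers at its ends accounts for the
extra step. -/
theorem exists_chamberGraph_walk {x y : V} (w : Δ.graph.Walk x y) {X Y : Δ.Chamber}
    (hX : x = X.1.1 ∨ x = X.1.2) (hY : y = Y.1.1 ∨ y = Y.1.2) :
    ∃ g : Δ.chamberGraph.Walk X Y, g.length ≤ w.length + 1 := by
  have share : ∀ {z : V} {X Y : Δ.Chamber}, (z = X.1.1 ∨ z = X.1.2) → (z = Y.1.1 ∨ z = Y.1.2) →
      ∃ g : Δ.chamberGraph.Walk X Y, g.length ≤ 1 := by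
    intro z X Y hX hY
    have hs : Chamber.SharePanel X Y := by
      have h1 := X.2.2
      have h2 := Y.2.2
      rcases hX with rfl | rfl <;> rcases hY with e | e
      · exact Or.inl e
      · rw [← e, h1.1] at h2; exact absurd h2.2 (by decide)
      · rw [← e, h1.2] at h2; exact absurd h2.1 (by decide)
      · exact Or.inr e
    by_cases he : X = Y
    · subst he; exact ⟨SimpleGraph.Walk.nil, by simp⟩
    · have hadj : Δ.chamberGraph.Adj X Y := ⟨he, hs⟩
      exact ⟨hadj.toWalk, le_rfl⟩
  induction w generalizing X with
  | nil => simpa using share hX hY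
  | @cons x z y h w ih =>
    obtain ⟨E, hx, hz⟩ : ∃ E : Δ.Chamber, (x = E.1.1 ∨ x = E.1.2) ∧ (z = E.1.1 ∨ z = E.1.2) := by
      refine ⟨Δ.chamberOfAdj h, ?_⟩
      unfold chamberOfAdj
      split_ifs <;> simp
    obtain ⟨g₁, h₁⟩ := share hX hx
    obtain ⟨g₂, h₂⟩ := ih hz hY
    exact ⟨g₁.append g₂, by rw [SimpleGraph.Walk.length_append, SimpleGraph.Walk.length_cons]; omega⟩

variable {Δ} in
theorem IsThick.exists_adj (hthick : Δ.IsThick) (v : V) : ∃ w, Δ.graph.Adj v w := by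
  have : (Δ.graph.neighborSet v).Nonempty := by
    rw [← Set.encard_pos]
    exact lt_of_lt_of_le (by norm_num) (hthick v)
  exact this

theorem isGeneralizedPolygon (hm : 3 ≤ m) (hthick : Δ.IsThick) [Nonempty V] :
    Δ.graph.IsGeneralizedPolygon m := by
  obtain ⟨𝒜, h𝒜⟩ := Δ.exists_apartments
  exact h𝒜.isGeneralizedPolygon (by omega) hthick.exists_adj

end RankTwoBuilding

namespace RankTwoBuilding

variable {V : Type*} {m : ℕ} {Δ : RankTwoBuilding V m}

/-- Gallery distance `m` forces vertex distance at least `m - 1`, and the choice of types excludes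
`m - 1` by parity. -/
theorem exists_opposite_vertices (hG : Δ.graph.IsGeneralizedPolygon m)
    {C C' : Δ.Chamber} (hopp : Opposite C C') : ∃ u u', Δ.graph.dist C.1.1 u = m ∧
      Δ.graph.dist C.1.2 u' = m ∧ (u = C'.1.1 ∨ u = C'.1.2) ∧ (u' = C'.1.1 ∨ u' = C'.1.2) := by
  have far : ∀ x y, (x = C.1.1 ∨ x = C.1.2) → (y = C'.1.1 ∨ y = C'.1.2) →
      (Even m ↔ Δ.typ x = Δ.typ y) → Δ.graph.dist x y = m := by
    intro x y hx hy hpar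
    obtain ⟨w, hw⟩ := hG.connected.exists_walk_length_eq_dist x y
    obtain ⟨g, hg⟩ := Δ.exists_chamberGraph_walk w hx hy
    have h1 := (SimpleGraph.dist_le g).trans hg
    rw [hopp, hw] at h1
    have h2 := hG.dist_le x y
    rw [← Δ.typ.even_dist_iff hG.connected] at hpar
    by_contra hne
    have e : m = Δ.graph.dist x y + 1 := by omega
    have h3 : Even m ↔ ¬ Even (Δ.graph.dist x y) := by
      rw [← Nat.even_add_one, ← e]
    tauto
  have h1 := C.2.2
  have h2 := C'.2.2
  by_cases he : Even m
  · exact ⟨C'.1.1, C'.1.2, far _ _ (Or.inl rfl) (Or.inl rfl) (by rw [h1.1, h2.1]; simpa),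
      far _ _ (Or.inr rfl) (Or.inr rfl) (by rw [h1.2, h2.2]; simpa), Or.inl rfl, Or.inr rfl⟩
  · exact ⟨C'.1.2, C'.1.1, far _ _ (Or.inl rfl) (Or.inr rfl) (by rw [h1.1, h2.2]; simp [he]),
      far _ _ (Or.inr rfl) (Or.inl rfl) (by rw [h1.2, h2.1]; simp [he]), Or.inr rfl, Or.inl rfl⟩

theorem chamberMap_of_typ_eq (φ : Δ.graph ≃g Δ.graph) (X : Δ.Chamber)
    (h : Δ.typ (φ X.1.1) = 0) : (Δ.chamberMap φ X).1 = (φ X.1.1, φ X.1.2) := by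
  unfold chamberMap chamberOfAdj
  rw [dif_pos h]

theorem chamberMap_of_typ_ne (φ : Δ.graph ≃g Δ.graph) (X : Δ.Chamber)
    (h : Δ.typ (φ X.1.1) ≠ 0) : (Δ.chamberMap φ X).1 = (φ X.1.2, φ X.1.1) := by
  unfold chamberMap chamberOfAdj
  rw [dif_neg h]

theorem typ_map_eq_of_typ_map_eq (hG : Δ.graph.Connected) (φ : Δ.graph ≃g Δ.graph) {p : V}
    (h : Δ.typ (φ p) = Δ.typ p) (x : V) : Δ.typ (φ x) = Δ.typ x := by
  obtain ⟨w⟩ := hG.preconnected p x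
  have h1 := Δ.typ.even_walk_length_iff w
  have h2 := Δ.typ.even_walk_length_iff (w.map φ.toHom)
  rw [SimpleGraph.Walk.length_map, h1] at h2
  have h3 : Δ.typ p = Δ.typ x ↔ Δ.typ (φ p) = Δ.typ (φ x) := h2
  omega

/-- Automorphisms moving the chambers in `E₁(C)` and `C'` only slightly preserve types and move
the vertices of these chambers only slightly. -/
theorem displacement_le [PseudoMetricSpace V] (hG : Δ.graph.Connected) {C C' : Δ.Chamber} {δ : ℝ}
    (hδ : 0 < δ) {a b : V} (ha : Δ.graph.Adj C.1.1 a) (hb : Δ.graph.Adj C.1.1 b)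
    (hab : 4 * δ < dist a b) (φ : Δ.graph ≃g Δ.graph)
    (h : ∀ X ∈ Δ.adjacentChambers C ∪ {C'}, dist X.1.1 (Δ.chamberMap φ X).1.1 ≤ δ ∧
      dist X.1.2 (Δ.chamberMap φ X).1.2 ≤ δ) :
    (∀ x, Δ.typ (φ x) = Δ.typ x) ∧
      ∀ X ∈ Δ.adjacentChambers C ∪ {C'}, dist X.1.1 (φ X.1.1) ≤ δ ∧ dist X.1.2 (φ X.1.2) ≤ δ := by
  have hC := C.2.2
  have h0 : Δ.typ (φ C.1.1) = 0 := by
    by_contra hne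
    -- If `φ` exchanged types, all chambers at `C.1.1` would acquire the same second vertex `φ
    -- C.1.1`, close to every neighbour `y`.
    have key : ∀ y, Δ.graph.Adj C.1.1 y → dist y (φ C.1.1) ≤ δ := by
      intro y hy
      have hy1 := Δ.typ.valid hy
      let X : Δ.Chamber := ⟨(C.1.1, y), hy, hC.1, by simp only; omega⟩
      have := (h X (Or.inl (Or.inl rfl))).2
      rwa [chamberMap_of_typ_ne φ X hne] at this
    have h1 := key a ha
    have h2 := key b hb
    rw [dist_comm] at h2
    linarith [dist_triangle a (φ C.1.1) b]
  have htyp := typ_map_eq_of_typ_map_eq hG φ (h0.trans hC.1.symm)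
  refine ⟨htyp, fun X hX => ?_⟩
  have := h X hX
  rwa [chamberMap_of_typ_eq φ X ((htyp _).trans X.2.2.1)] at this

section Topology

variable [TopologicalSpace V]

theorem isClosed_adj (hcl : IsClosed Δ.chamberSet) :
    IsClosed {p : V × V | Δ.graph.Adj p.1 p.2} := by
  have : {p : V × V | Δ.graph.Adj p.1 p.2} = Δ.chamberSet ∪ Prod.swap ⁻¹' Δ.chamberSet := by
    ext ⟨x, y⟩
    constructor
    · intro h
      have h' : Δ.graph.Adj x y := h
      have h1 := Δ.typ.valid h'
      by_cases hx : Δ.typ x = 0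
      · exact Or.inl ⟨h', hx, by simp only; omega⟩
      · exact Or.inr ⟨h'.symm, by simp only [Prod.swap]; omega, by simp only [Prod.swap]; omega⟩
    · rintro (h | h)
      · exact h.1
      · exact h.1.symm
  rw [this]
  exact hcl.union (hcl.preimage continuous_swap)

/-- The type classes are the two projections of the compact chamber set, hence closed, and they are
complementary. -/
theorem continuous_typ [CompactSpace V] [T2Space V] (hcl : IsClosed Δ.chamberSet)
    (hnb : ∀ v, ∃ w, Δ.graph.Adj v w) : Continuous Δ.typ := by
  have h0 : Δ.typ ⁻¹' {0} = Prod.fst '' Δ.chamberSet := by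
    ext x
    constructor
    · intro hx
      obtain ⟨y, hy⟩ := hnb x
      have h1 := Δ.typ.valid hy
      have hx' : Δ.typ x = 0 := hx
      exact ⟨(x, y), ⟨hy, hx', by simp only; omega⟩, rfl⟩
    · rintro ⟨p, hp, rfl⟩; exact hp.2.1
  have h1 : Δ.typ ⁻¹' {1} = Prod.snd '' Δ.chamberSet := by
    ext x
    constructor
    · intro hx
      obtain ⟨y, hy⟩ := hnb x
      have h1 := Δ.typ.valid hy
      have hx' : Δ.typ x = 1 := hx
      exact ⟨(y, x), ⟨hy.symm, by simp only; omega, hx'⟩, rfl⟩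
    · rintro ⟨p, hp, rfl⟩; exact hp.2.2
  have c0 : IsClosed (Δ.typ ⁻¹' {0}) := h0 ▸ (hcl.isCompact.image continuous_fst).isClosed
  have c1 : IsClosed (Δ.typ ⁻¹' {1}) := h1 ▸ (hcl.isCompact.image continuous_snd).isClosed
  refine continuous_discrete_rng.2 fun b => ?_
  have e : ∀ b : Fin 2, b = 0 ∨ b = 1 := by decide
  rcases e b with rfl | rfl
  · have : Δ.typ ⁻¹' {0} = (Δ.typ ⁻¹' {1})ᶜ := by
      ext x; simp only [Set.mem_preimage, Set.mem_singleton_iff, Set.mem_compl_iff]; omega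
    rw [this]; exact c1.isOpen_compl
  · have : Δ.typ ⁻¹' {1} = (Δ.typ ⁻¹' {0})ᶜ := by
      ext x; simp only [Set.mem_preimage, Set.mem_singleton_iff, Set.mem_compl_iff]; omega
    rw [this]; exact c0.isOpen_compl

theorem isHomeomorph_chamberMap [CompactSpace V] [T2Space V] (hcl : IsClosed Δ.chamberSet)
    {f : Δ.graph ≃g Δ.graph} (hf : IsHomeomorph f) (htyp : ∀ x, Δ.typ (f x) = Δ.typ x) :
    IsHomeomorph (Δ.chamberMap f) := by
  have : CompactSpace Δ.Chamber := isCompact_iff_compactSpace.1 hcl.isCompact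
  refine isHomeomorph_iff_continuous_bijective.2 ⟨?_, ?_⟩
  · refine continuous_induced_rng.2 ?_
    have : Subtype.val ∘ Δ.chamberMap f = fun X : Δ.Chamber => (f X.1.1, f X.1.2) :=
      funext fun X => chamberMap_of_typ_eq f X ((htyp _).trans X.2.2.1)
    rw [this]
    have := hf.continuous
    fun_prop
  · refine Function.bijective_iff_has_inverse.2 ⟨Δ.chamberMap f⁻¹, fun X => ?_, fun X => ?_⟩
    · have := congrFun (Δ.chamberMap_mul f⁻¹ f) X
      rw [inv_mul_cancel, chamberMap_one] at this
      exact this.symm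
    · have := congrFun (Δ.chamberMap_mul f f⁻¹) X
      rw [mul_inv_cancel, chamberMap_one] at this
      exact this.symm

theorem tendsto_chamberMap [CompactSpace V] {ι : Type*} {U : Ultrafilter ι}
    {φ : ι → Δ.graph ≃g Δ.graph} {f : Δ.graph ≃g Δ.graph}
    (hφ : ∀ᶠ i in U, ∀ x, Δ.typ (φ i x) = Δ.typ x) (hf : ∀ x, Δ.typ (f x) = Δ.typ x)
    (h : ∀ a, Δ.graph.movedLimit φ U a = f (U.limit a)) {X : ι → Δ.Chamber} {X₀ : Δ.Chamber}
    [T2Space V] (hX : Tendsto X U (𝓝 X₀)) :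
    Tendsto (fun i => Δ.chamberMap (φ i) (X i)) U (𝓝 (Δ.chamberMap f X₀)) := by
  rw [tendsto_subtype_rng] at hX ⊢
  rw [chamberMap_of_typ_eq f X₀ ((hf _).trans X₀.2.2.1)]
  have lim : ∀ {a : ι → V} {x : V}, Tendsto a U (𝓝 x) →
      Tendsto (fun i => φ i (a i)) U (𝓝 (f x)) := by
    intro a x ha
    rw [← Ultrafilter.limit_eq ha, ← h]
    exact U.tendsto_limit _
  have h1 := lim ((continuous_fst.tendsto _).comp hX)
  have h2 := lim ((continuous_snd.tendsto _).comp hX)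
  refine (h1.prodMk_nhds h2).congr' (hφ.mono fun i hi => ?_)
  exact (chamberMap_of_typ_eq (φ i) (X i) ((hi _).trans (X i).2.2.1)).symm

/-- If convergence failed for `K` and `O`, a choice of chambers in `K` sent outside `O` would have
its limit in `K`, and the moved chambers would tend to a point of `O`. -/
theorem le_nhds_of_movedLimit [CompactSpace V] [T2Space V] (hcl : IsClosed Δ.chamberSet)
    {U : Ultrafilter Δ.topAut} {f : Δ.topAut}
    (hφ : ∀ᶠ φ : Δ.topAut in U, ∀ x, Δ.typ (φ.1 x) = Δ.typ x) (hf : ∀ x, Δ.typ (f.1 x) = Δ.typ x)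
    (h : ∀ a, Δ.graph.movedLimit (fun φ : Δ.topAut => φ.1) U a = f.1 (U.limit a)) :
    ↑U ≤ 𝓝 f := by
  have : CompactSpace Δ.Chamber := isCompact_iff_compactSpace.1 hcl.isCompact
  rw [nhds_induced, ← tendsto_iff_comap, ContinuousMap.tendsto_nhds_compactOpen]
  intro K hK O hO hmaps
  by_contra hcon
  rw [← Ultrafilter.eventually_not] at hcon
  have : ∀ φ : Δ.topAut, ∃ X, ¬ Set.MapsTo (Δ.topAutToContinuousMap φ) K O →
      X ∈ K ∧ Δ.chamberMap φ.1 X ∉ O := by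
    intro φ
    by_cases hm : Set.MapsTo (Δ.topAutToContinuousMap φ) K O
    · have hne : Nonempty Δ.Chamber := by
        obtain ⟨ψ, hψ⟩ := hcon.exists
        unfold Set.MapsTo at hψ
        push Not at hψ
        exact ⟨hψ.choose⟩
      exact ⟨hne.some, fun h => absurd hm h⟩
    · unfold Set.MapsTo at hm
      push Not at hm
      obtain ⟨X, h1, h2⟩ := hm
      exact ⟨X, fun _ => ⟨h1, h2⟩⟩
  choose X hX using this
  have hXK : U.limit X ∈ K := Ultrafilter.limit_mem hK.isClosed (hcon.mono fun φ hφ => (hX φ hφ).1)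
  have hlim := tendsto_chamberMap hφ hf h (U.tendsto_limit X)
  have hin : Δ.chamberMap f.1 (U.limit X) ∈ O := hmaps hXK
  obtain ⟨φ, h1, h2⟩ := ((hlim.eventually_mem (hO.mem_nhds hin)).and hcon).exists
  exact (hX φ h2).2 h1

end Topology

end RankTwoBuilding

/-! ### Compactness of the set of almost fixing automorphisms -/

theorem mainTheorem4 {V : Type*} [TopologicalSpace V] {m : ℕ} (hm : 3 ≤ m)
    (Δ : RankTwoBuilding V m) (hthick : Δ.IsThick) (hcompact : Δ.IsCompactBuilding)
    (ρ : MetricSpace Δ.Chamber)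
    (hρ : ρ.toUniformSpace.toTopologicalSpace =
      (instTopologicalSpaceSubtype : TopologicalSpace Δ.Chamber))
    (C C' : Δ.Chamber) (hopp : RankTwoBuilding.Opposite C C') :
    ∃ ε : ℝ, 0 < ε ∧ IsCompact (Δ.almostFixing ρ C C' ε) := by
  have := hcompact.compactSpace
  have := hcompact.metrizableSpace
  let : MetricSpace V := TopologicalSpace.metrizableSpaceMetric V
  have hclosed := hcompact.isClosed_chamberSet
  have : CompactSpace Δ.Chamber := isCompact_iff_compactSpace.1 hclosed.isCompact
  have : Nonempty V := ⟨C.1.1⟩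
  have hG := Δ.isGeneralizedPolygon hm hthick
  have hadj := RankTwoBuilding.isClosed_adj hclosed
  obtain ⟨u, u', hu, hu', huC, huC'⟩ := RankTwoBuilding.exists_opposite_vertices hG hopp
  obtain ⟨δ₁, hδ₁⟩ := exists_isMargin hG hm hadj hthick hu
  obtain ⟨δ₂, hδ₂⟩ := exists_isMargin hG hm hadj hthick hu'
  have hδ : 0 < min δ₁ δ₂ := lt_min hδ₁.pos hδ₂.pos
  replace hδ₁ := hδ₁.mono hδ (min_le_left _ _)
  replace hδ₂ := hδ₂.mono hδ (min_le_right _ _)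
  generalize min δ₁ δ₂ = δ at hδ hδ₁ hδ₂
  -- Uniform continuity of the inclusion of chambers into `V × V` turns `ρ`-displacement into
  -- displacement of vertices.
  obtain ⟨ε, hε, hεδ⟩ := MetricSpace.exists_pos_forall_dist_le ρ hρ
    (g := fun X : Δ.Chamber => X.1) continuous_subtype_val hδ
  refine ⟨ε, hε, isCompact_iff_ultrafilter_le_nhds'.2 fun U hU => ?_⟩
  obtain ⟨q, hq, hqδ⟩ := hδ₁.separated
  have hmove : ∀ᶠ φ : Δ.topAut in U, (∀ x, Δ.typ (φ.1 x) = Δ.typ x) ∧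
      ∀ X ∈ Δ.adjacentChambers C ∪ {C'}, dist X.1.1 (φ.1 X.1.1) ≤ δ ∧
        dist X.1.2 (φ.1 X.1.2) ≤ δ := by
    filter_upwards [hU] with φ hφ
    refine RankTwoBuilding.displacement_le hG.connected hδ (hq 0) (hq 1) (hqδ 0 1 (by decide)) φ.1
      fun X hX => ?_
    have := hεδ _ _ (hφ X hX)
    rw [Prod.dist_eq] at this
    exact max_le_iff.1 this
  have htyp : ∀ᶠ φ : Δ.topAut in U, ∀ x, Δ.typ (φ.1 x) = Δ.typ x := hmove.mono fun φ h => h.1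
  have hC := C.2
  have R := hG.residuePair hm hthick.exists_adj hadj
    (RankTwoBuilding.continuous_typ hclosed hthick.exists_adj) (fun φ : Δ.topAut => φ.1) U htyp
  have hmoveC' : ∀ v, (v = C'.1.1 ∨ v = C'.1.2) → ∀ᶠ φ : Δ.topAut in U, dist v (φ.1 v) ≤ δ := by
    rintro v hv
    filter_upwards [hmove] with φ hφ
    have := hφ.2 C' (Or.inr rfl)
    rcases hv with rfl | rfl
    · exact this.1
    · exact this.2
  obtain ⟨hgood₁, htame₁⟩ := R.good_and_isTame_of_isMargin hδ₁
    (hmove.mono fun φ h => (h.2 C (Or.inl (Or.inl rfl))).1) (hmoveC' u huC)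
    (hmove.mono fun φ h o ho => by
      have := Δ.typ.valid ho
      exact (h.2 ⟨(C.1.1, o), ho, hC.2.1, by have := hC.2.1; simp only; omega⟩
        (Or.inl (Or.inl rfl))).2)
  obtain ⟨hgood₂, htame₂⟩ := R.good_and_isTame_of_isMargin hδ₂
    (hmove.mono fun φ h => (h.2 C (Or.inl (Or.inl rfl))).2) (hmoveC' u' huC')
    (hmove.mono fun φ h o ho => by
      have := Δ.typ.valid ho
      exact (h.2 ⟨(o, C.1.2), ho.symm, by have := hC.2.2; simp only; omega, hC.2.2⟩
        (Or.inl (Or.inr rfl))).1)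
  have hpq : (Δ.graph.ultrapower (U : Ultrafilter Δ.topAut)).Adj (fun _ => C.1.1)
      (fun _ => C.1.2) := Filter.Eventually.of_forall fun _ => hC.1
  obtain ⟨f, hf, hftyp, hfU⟩ := R.exists_limit_iso (fun φ => φ.2.1.continuous)
    (R.eq_iff_eq_of_isTame (R.good_of_good hpq hgood₁ hgood₂) hpq htame₁ htame₂)
  have hfmem : f ∈ Δ.topAut := ⟨hf, RankTwoBuilding.isHomeomorph_chamberMap hclosed hf hftyp⟩
  refine ⟨⟨f, hfmem⟩, fun X hX => ?_,
    RankTwoBuilding.le_nhds_of_movedLimit hclosed htyp hftyp hfU⟩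
  exact (MetricSpace.isClosed_setOf_dist_le ρ hρ X ε).mem_of_tendsto
    (RankTwoBuilding.tendsto_chamberMap htyp hftyp hfU tendsto_const_nhds)
    (Filter.mem_of_superset hU fun φ hφ => hφ X hX)
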